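/- \textbf{Setting.} Let $\mathcal A$ be a finite non-empty set of actions and $d\ge 1$. Each action $a$ has an expected outcome $\mu_a\in[0,1]^d$. Let $f:\mathbb R^d\to\mathbb R$ be a measurable preference function such that $f(x)\le f(y)$ whenever $x_i<y_i$ for all $i$. Let $\mathcal O=\operatorname{argmax}_{a\in\mathcal A} f(\mu_a)$ be the set of optimal actions; for $\star\in\mathcal O$ let $\Delta_a=f(\mu_\star)-f(\mu_a)$, and call $a\notin\mathcal O$ suboptimal. Numbers $\rho_a>0$ $(a\in\mathcal A)$ are \emph{preference radii} if for all $(\theta_a)_{a\in\mathcal A}$ in $\mathbb R^d$ with $|\theta_{a,i}-\mu_{a,i}|<\rho_a$ for all $a$ and $i$, some optimal action belongs to $\operatorname{argmax}_{a} f(\theta_a)$ and no suboptimal action does. \emph{Thompson sampling from multivariate normal priors} proceeds in episodes $t=1,2,\dots$. Let $\mathcal F_t$ be the $\sigma$-algebra generated by the actions $a(s)$ and outcomes $z(s)$ with $s<t$, let $N_a(t)=\#\{s<t: a(s)=a\}$ and $\hat\mu_a(t)=\frac1{N_a(t)+1}\sum_{s<t,\,a(s)=a} z(s)$. Conditionally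 on $\mathcal F_t$, samples $\theta_a(t)\sim\mathcal N_d\big(\hat\mu_a(t),(I_d+N_a(t)I_d)^{-1}\big)$ are drawn independently over $a\in\mathcal A$ (the posteriors for the prior $\mathcal N_d(0,I_d)$ and Gaussian likelihood with covariance $I_d$); an action $a(t)\in\operatorname{argmax}_{a} f(\theta_a(t))$ is played, ties being broken in any measurable way; and $z(t)=\mu_{a(t)}+\xi(t)$ is observed. The noise vectors $\xi(t)$ are identically distributed, each $\xi(t)$ is independent of $\mathcal F_t$, $(\theta_a(t))_a$ and $a(t)$ jointly, and every coordinate is $\sigma$-sub-Gaussian, i.e. $\mathbb E\,e^{\lambda \xi_i(t)}\le e^{\lambda^2\sigma^2/2}$ for all $\lambda\in\mathbb R$. The expected regret is $\mathfrak R(T)=\sum_{t=1}^T\mathbb E\big[f(\mu_\star)-f(\mu_{a(t)})\big]$. Write $\ln^+ y=\max(0,\ln y)$ for $y>0$ and $\ln^+0=0$. Let $C(d)$ be any real number such that $$\exp\Big(-\frac{\sqrt i}{\sqrt{18\pi d\ln i}^{\,d}}\Big)\le\frac d{i^2}\qquad\text{for all integers } i\ge \max(1,C(d)),$$ where for $i=1$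 (division by $\sqrt{\ln 1}=0$) the inequality is regarded as satisfied. \textbf{Proposition.} Let $(\rho_a)_{a\in\mathcal A}$ be preference radii. There is an optimal action $\star\in\mathcal O$ (the optimal action, if it is unique), depending only on $f$, $(\mu_a)$ and $(\rho_a)$, such that the following holds for every choice of quantities $0<r_a<\rho_a$ ($a$ suboptimal), every $\sigma\ge0$ with $\sigma^2\le 1/(4d)$, every run of Thompson sampling as above and every $T\ge 0$. For every suboptimal action $a$, $$\sum_{t=1}^T\Pr[a(t)=a]\le B_a:=(2C(d)+8d)(1+\sigma)^2\frac{\ln^+(dT\Delta_a^2)}{\rho_\star^2}+\frac{2\ln^+(dT\Delta_a^2)}{(\rho_a-r_a)^2}+\frac{2\sigma^2\ln^+(dT\Delta_a^2)}{r_a^2}+\frac4{\Delta_a^2},$$ and consequently $\mathfrak R(T)\le\sum_{a\notin\mathcal O}\Delta_a B_a$. -/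

import Mathlib

open MeasureTheory ProbabilityTheory
open scoped NNReal

noncomputable section

namespace MOBandit

/-- The actions whose value vector `x a` maximizes the preference function `f`.  With `x` the vector
of expected outcomes this is the set `𝒪` of optimal actions; with `x` the current estimates it is
the set `𝒪(t)` of actions among which the agent plays. -/
def argmaxSet {A : Type*} {d : ℕ} (f : EuclideanSpace ℝ (Fin d) → ℝ)
    (x : A → EuclideanSpace ℝ (Fin d)) : Set A :=
  {a | ∀ b, f (x b) ≤ f (x a)}

open Classical in
/-- The finite set of suboptimal actions. -/
def suboptimal {A : Type*} [Fintype A] {d : ℕ} (f : EuclideanSpace ℝ (Fin d) → ℝ)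
    (μ : A → EuclideanSpace ℝ (Fin d)) : Finset A :=
  Finset.univ.filter (fun a => a ∉ argmaxSet f μ)

/-- `f` respects strict Pareto dominance: a vector that is larger in every coordinate is at least
as good. -/
def RespectsDominance {d : ℕ} (f : EuclideanSpace ℝ (Fin d) → ℝ) : Prop :=
  ∀ x y : EuclideanSpace ℝ (Fin d), (∀ i, x i < y i) → f x ≤ f y

/-- `ρ` is a family of preference radii for the preference function `f` and the expected outcomes
`μ`: the radii are positive, and as soon as the estimate of every action `a` lies in the open
sup-norm ball of radius `ρ a` around `μ a`, some optimal action maximizes `f` over the estimates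
and no suboptimal action does. -/
structure IsPreferenceRadii {A : Type*} {d : ℕ} (f : EuclideanSpace ℝ (Fin d) → ℝ)
    (μ : A → EuclideanSpace ℝ (Fin d)) (ρ : A → ℝ) : Prop where
  pos : ∀ a, 0 < ρ a
  robust : ∀ θ : A → EuclideanSpace ℝ (Fin d), (∀ a i, |θ a i - μ a i| < ρ a) →
    (∃ s ∈ argmaxSet f μ, s ∈ argmaxSet f θ) ∧ ∀ a, a ∉ argmaxSet f μ → a ∉ argmaxSet f θ

section Run

variable {A Ω : Type*} {d : ℕ}

open Classical in
/-- The number of plays of action `a` in the episodes before episode `t`.  Episodes are numbered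
`0, 1, 2, …`. -/
def playCount (act : ℕ → Ω → A) (a : A) (t : ℕ) (ω : Ω) : ℕ :=
  ((Finset.range t).filter (fun s => act s ω = a)).card

open Classical in
/-- Posterior mean of action `a` before episode `t`, for the prior `N(0, I)` and the Gaussian
likelihood with identity covariance: the sum of the outcomes of `a` observed so far, divided by
the number of plays plus one. -/
def postMean (act : ℕ → Ω → A) (z : ℕ → Ω → EuclideanSpace ℝ (Fin d)) (a : A) (t : ℕ) (ω : Ω) :
    EuclideanSpace ℝ (Fin d) :=
  ((playCount act a t ω : ℝ) + 1)⁻¹ •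
    ∑ s ∈ (Finset.range t).filter (fun s => act s ω = a), z s ω

/-- Posterior covariance `(I + N I)⁻¹` of action `a` before episode `t`. -/
def postCov (d : ℕ) (act : ℕ → Ω → A) (a : A) (t : ℕ) (ω : Ω) : Matrix (Fin d) (Fin d) ℝ :=
  (1 + (playCount act a t ω : ℝ) • (1 : Matrix (Fin d) (Fin d) ℝ))⁻¹

/-- Joint law of the samples of all actions in episode `t`: independent over the actions, the
sample of `a` being drawn from its multivariate normal posterior. -/
def posterior [Fintype A] (act : ℕ → Ω → A) (z : ℕ → Ω → EuclideanSpace ℝ (Fin d)) (t : ℕ)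
    (ω : Ω) : Measure (A → EuclideanSpace ℝ (Fin d)) :=
  Measure.pi fun a => multivariateGaussian (postMean act z a t ω) (postCov d act a t ω)

/-- The σ-algebra generated by the actions and outcomes of the episodes before episode `t`. -/
abbrev history [MeasurableSpace A] (act : ℕ → Ω → A) (z : ℕ → Ω → EuclideanSpace ℝ (Fin d))
    (t : ℕ) : MeasurableSpace Ω :=
  ⨆ s ∈ Finset.range t,
    (MeasurableSpace.comap (act s) inferInstance ⊔ MeasurableSpace.comap (z s) inferInstance)

/-- The processes `act` (actions), `θ` (posterior samples), `ξ` (noise) and `z` (outcomes) form a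
run of Thompson sampling from multivariate normal priors in the multi-objective bandit with
expected outcomes `μ` and preference function `f`.  Ties in the maximization may be broken in any
measurable way. -/
structure IsThompsonRun [Fintype A] [MeasurableSpace A] [MeasurableSpace Ω] (P : Measure Ω)
    (f : EuclideanSpace ℝ (Fin d) → ℝ) (μ : A → EuclideanSpace ℝ (Fin d))
    (act : ℕ → Ω → A) (θ : ℕ → Ω → A → EuclideanSpace ℝ (Fin d))
    (ξ z : ℕ → Ω → EuclideanSpace ℝ (Fin d)) : Prop where
  measurable_act : ∀ t, Measurable (act t)
  measurable_sample : ∀ t, Measurable (θ t)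
  measurable_noise : ∀ t, Measurable (ξ t)
  /-- Given the past actions and outcomes, the samples follow the current posteriors. -/
  sample_law : ∀ t, ∀ B : Set (A → EuclideanSpace ℝ (Fin d)), MeasurableSet B →
    P⟦θ t ⁻¹' B | history act z t⟧ =ᵐ[P] fun ω => (posterior act z t ω).real B
  /-- The played action maximizes the preference function over the samples. -/
  plays_argmax : ∀ t ω, act t ω ∈ argmaxSet f (θ t ω)
  /-- The observed outcome is the expected outcome of the played action plus noise. -/
  outcome_eq : ∀ t ω, z t ω = μ (act t ω) + ξ t ω
  /-- The noise is identically distributed over the episodes ... -/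
  noise_ident : ∀ t, IdentDistrib (ξ t) (ξ 0) P P
  /-- ... and independent of everything the agent has seen, sampled and decided before it. -/
  noise_indep : ∀ t, Indep (MeasurableSpace.comap (ξ t) inferInstance)
    (history act z t ⊔ MeasurableSpace.comap (θ t) inferInstance
      ⊔ MeasurableSpace.comap (act t) inferInstance) P

/-- Expected number of plays of `a` in the first `T` episodes, `∑ₜ Pr[a(t) = a]`. -/
def expectedPlays [MeasurableSpace Ω] (P : Measure Ω) (act : ℕ → Ω → A) (a : A) (T : ℕ) : ℝ :=
  ∑ t ∈ Finset.range T, P.real {ω | act t ω = a}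

/-- Optimality gap of `a` with respect to the optimal action `s`. -/
def gap (f : EuclideanSpace ℝ (Fin d) → ℝ) (μ : A → EuclideanSpace ℝ (Fin d)) (s a : A) : ℝ :=
  f (μ s) - f (μ a)

/-- Expected cumulative regret of the first `T` episodes, `s` being an optimal action. -/
def expectedRegret [MeasurableSpace Ω] (P : Measure Ω) (f : EuclideanSpace ℝ (Fin d) → ℝ)
    (μ : A → EuclideanSpace ℝ (Fin d)) (s : A) (act : ℕ → Ω → A) (T : ℕ) : ℝ :=
  ∑ t ∈ Finset.range T, ∫ ω, gap f μ s (act t ω) ∂P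

end Run

/-- The requirement on the constant `C(d)`: the inequality
`exp (-√i / (√(18 π d ln i))^d) ≤ d / i²` holds for all integers `i ≥ C(d)`. -/
def IsCountConstant (d : ℕ) (C : ℝ) : Prop :=
  ∀ i : ℕ, 1 ≤ i → C ≤ i →
    Real.exp (-(Real.sqrt i / (Real.sqrt (18 * Real.pi * d * Real.log i)) ^ d)) ≤ d / (i : ℝ) ^ 2

end MOBandit

end

open scoped ENNReal

/-! Preference radii yield one optimal action s whose samples, once above μ_s − ρ_s in every
coordinate, beat every sample of a suboptimal a that stays below μ_a + ρ_a
(`IsPreferenceRadii.exists_separated_oneSided`). A play of a therefore has one of two causes.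

Either the sample of a is below μ_a + ρ_a, and then the sample of s misses its orthant. Given the
past, the sample of s is independent of the others. If p is the posterior probability of the
orthant, a miss with the other samples fixed is (1 − p)/p times as likely as a hit, and a hit forces
s to be played (`measure_miss_le`, `measure_play_le_odds`). So these plays of a are paid for by the
odds (1 − p)/p summed over plays of s. Each play count of s occurs at most once, which turns the sum
into one over counts n. After n plays the odds are controlled by exponentials of the squared
normalized noise, whose mean is bounded because σ² ≤ 1/(4d). For n of order L/ρ_s² and beyond they
are of order d·exp(−L) (`sum_lintegral_odds_le`).

Or the sample of a is too large in some coordinate. Then a has been played rarely, or its average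
noise exceeds r_a, or its sample exceeds the posterior mean by ρ_a − r_a. The last two are bounded
by Chernoff.

With L = ln(dTΔ_a²) the four error terms T·d·exp(−L) add up to 4/Δ_a². If dTΔ_a² ≤ 4d, already T ≤
4/Δ_a². The constant C(d) matters only through its size: its defining inequality forces it to exceed
what the odds bound needs (`IsCountConstant.mul_pow_le`). -/

namespace MOBandit

/-! ### Gaussian tails and the product form of the posterior. -/

/-- Lower bound for the upper tail of the standard normal distribution. -/
lemma gaussianReal_Ioi_ge {x : ℝ} (hx : 0 ≤ x) :
    ENNReal.ofReal ((√(2 * Real.pi))⁻¹ * Real.exp (-(x + 1) ^ 2 / 2)) ≤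
      gaussianReal 0 1 (Set.Ioi x) := by
  rw [gaussianReal_apply _ one_ne_zero]
  -- Only the mass of (x, x + 1] is kept; there the density is smallest at the right end.
  calc ENNReal.ofReal ((√(2 * Real.pi))⁻¹ * Real.exp (-(x + 1) ^ 2 / 2))
      = ∫⁻ _ in Set.Ioc x (x + 1),
          ENNReal.ofReal ((√(2 * Real.pi))⁻¹ * Real.exp (-(x + 1) ^ 2 / 2)) := by
        simp
    _ ≤ ∫⁻ y in Set.Ioc x (x + 1), gaussianPDF 0 1 y := by
        refine setLIntegral_mono (measurable_gaussianPDF _ _) fun y hy => ?_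
        rw [gaussianPDF, gaussianPDFReal]
        refine ENNReal.ofReal_le_ofReal ?_
        simp only [NNReal.coe_one, mul_one, sub_zero]
        gcongr
        · exact hx.trans hy.1.le
        · exact hy.2
    _ ≤ ∫⁻ y in Set.Ioi x, gaussianPDF 0 1 y :=
        lintegral_mono_set Set.Ioc_subset_Ioi_self

lemma hasSubgaussianMGF_gaussianReal (v : ℝ≥0) :
    HasSubgaussianMGF (fun x : ℝ => x) v (gaussianReal 0 v) where
  integrable_exp_mul t := integrable_exp_mul_gaussianReal t
  mgf_le t := by
    have := congrFun (mgf_fun_id_gaussianReal (μ := 0) (v := v)) t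
    rw [this]
    simp

/-- Chernoff bound for the upper tail of the standard normal distribution. -/
lemma gaussianReal_Ici_le {x : ℝ} (hx : 0 ≤ x) :
    gaussianReal 0 1 (Set.Ici x) ≤ ENNReal.ofReal (Real.exp (-x ^ 2 / 2)) := by
  have h := (hasSubgaussianMGF_gaussianReal 1).measure_ge_le hx
  rw [← ofReal_measureReal]
  refine ENNReal.ofReal_le_ofReal ?_
  simpa [Set.Ici] using h

lemma gaussianReal_Iic_neg_le {x : ℝ} (hx : 0 ≤ x) :
    gaussianReal 0 1 (Set.Iic (-x)) ≤ ENNReal.ofReal (Real.exp (-x ^ 2 / 2)) := by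
  have h := (hasSubgaussianMGF_gaussianReal 1).neg.measure_ge_le hx
  rw [← ofReal_measureReal]
  refine ENNReal.ofReal_le_ofReal ?_
  have e : {ω : ℝ | x ≤ (-fun x : ℝ => x) ω} = Set.Iic (-x) := by
    ext y; simp [le_neg]
  rw [e] at h
  simpa using h

/-- A normal distribution with variance `k⁻¹` as an image of the standard one. -/
lemma gaussianReal_inv_eq_map (m : ℝ) {k : ℝ} (hk : 0 < k) :
    gaussianReal m (k⁻¹).toNNReal = (gaussianReal 0 1).map (fun x => m + (√k)⁻¹ * x) := by
  have h : (fun x => m + (√k)⁻¹ * x) = (fun x => m + x) ∘ (fun x => (√k)⁻¹ * x) := rfl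
  rw [h, ← Measure.map_map (by fun_prop) (by fun_prop), gaussianReal_map_const_mul,
    gaussianReal_map_const_add]
  congr 1
  · simp
  · ext
    simp [Real.sq_sqrt hk.le, hk.le]

lemma gaussianReal_inv_Ioi (m c : ℝ) {k : ℝ} (hk : 0 < k) :
    gaussianReal m (k⁻¹).toNNReal (Set.Ioi c) = gaussianReal 0 1 (Set.Ioi (√k * (c - m))) := by
  rw [gaussianReal_inv_eq_map m hk, Measure.map_apply (by fun_prop) measurableSet_Ioi]
  congr 1
  ext x
  have := Real.sqrt_pos.2 hk
  simp only [Set.mem_preimage, Set.mem_Ioi]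
  rw [← sub_lt_iff_lt_add', inv_mul_eq_div, lt_div_iff₀ this, mul_comm]

lemma gaussianReal_inv_Ici (m c : ℝ) {k : ℝ} (hk : 0 < k) :
    gaussianReal m (k⁻¹).toNNReal (Set.Ici c) = gaussianReal 0 1 (Set.Ici (√k * (c - m))) := by
  rw [gaussianReal_inv_eq_map m hk, Measure.map_apply (by fun_prop) measurableSet_Ici]
  congr 1
  ext x
  have := Real.sqrt_pos.2 hk
  simp only [Set.mem_preimage, Set.mem_Ici]
  rw [← sub_le_iff_le_add', inv_mul_eq_div, le_div_iff₀ this, mul_comm]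

lemma gaussianReal_inv_Iic (m c : ℝ) {k : ℝ} (hk : 0 < k) :
    gaussianReal m (k⁻¹).toNNReal (Set.Iic c) = gaussianReal 0 1 (Set.Iic (√k * (c - m))) := by
  rw [gaussianReal_inv_eq_map m hk, Measure.map_apply (by fun_prop) measurableSet_Iic]
  congr 1
  ext x
  have := Real.sqrt_pos.2 hk
  simp only [Set.mem_preimage, Set.mem_Iic]
  rw [← le_sub_iff_add_le', inv_mul_eq_div, div_le_iff₀ this, mul_comm]

/-- A normal distribution with scalar covariance has independent coordinates. -/
lemma multivariateGaussian_smul_one {d : ℕ} (m : EuclideanSpace ℝ (Fin d)) (v : ℝ≥0) :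
    multivariateGaussian m ((v : ℝ) • (1 : Matrix (Fin d) (Fin d) ℝ)) =
      (Measure.pi fun i => gaussianReal (m i) v).map (WithLp.toLp 2) := by
  have hS : ((v : ℝ) • (1 : Matrix (Fin d) (Fin d) ℝ)).PosSemidef :=
    Matrix.PosSemidef.one.smul v.2
  apply Measure.ext_of_charFun (E := EuclideanSpace ℝ (Fin d))
  ext t
  rw [charFun_multivariateGaussian hS]
  simp_rw [charFun_pi, charFun_gaussianReal, ← Complex.exp_sum]
  congr 1
  simp only [Finset.sum_sub_distrib, PiLp.inner_apply, Matrix.smul_mulVec, Matrix.one_mulVec]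
  simp [dotProduct, Finset.sum_div, Finset.mul_sum, mul_comm, mul_left_comm, sq]

variable {A Ω : Type*} {d : ℕ}

lemma postCov_eq (act : ℕ → Ω → A) (a : A) (t : ℕ) (ω : Ω) :
    postCov d act a t ω =
      (((((playCount act a t ω : ℝ) + 1)⁻¹).toNNReal : ℝ≥0) : ℝ) •
        (1 : Matrix (Fin d) (Fin d) ℝ) := by
  have h : (0 : ℝ) < (playCount act a t ω : ℝ) + 1 := by positivity
  rw [Real.coe_toNNReal _ (by positivity), postCov]
  refine Matrix.inv_eq_left_inv ?_
  rw [smul_mul_assoc, one_mul]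
  nth_rw 1 [← one_smul ℝ (1 : Matrix (Fin d) (Fin d) ℝ)]
  rw [← add_smul, smul_smul, add_comm 1, inv_mul_cancel₀ h.ne', one_smul]

/-- The posterior of one action is a product of one-dimensional normal distributions. -/
lemma posterior_marginal (act : ℕ → Ω → A) (z : ℕ → Ω → EuclideanSpace ℝ (Fin d)) (a : A) (t : ℕ)
    (ω : Ω) :
    multivariateGaussian (postMean act z a t ω) (postCov d act a t ω) =
      (Measure.pi fun i => gaussianReal (postMean act z a t ω i)
        (((playCount act a t ω : ℝ) + 1)⁻¹).toNNReal).map (WithLp.toLp 2) := by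
  rw [postCov_eq, multivariateGaussian_smul_one]

/-! ### Exponential moments and tails of sub-Gaussian variables. -/

lemma lintegral_exp_mul_le {Ω : Type*} [MeasurableSpace Ω] {P : Measure Ω} {X : Ω → ℝ} {c : ℝ≥0}
    (h : HasSubgaussianMGF X c P) (t : ℝ) :
    ∫⁻ ω, ENNReal.ofReal (Real.exp (t * X ω)) ∂P ≤
      ENNReal.ofReal (Real.exp (c * t ^ 2 / 2)) := by
  rw [← ofReal_integral_eq_lintegral_ofReal (h.integrable_exp_mul t)
    (Filter.Eventually.of_forall fun _ => (Real.exp_pos _).le)]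
  exact ENNReal.ofReal_le_ofReal (h.mgf_le t)

/-- The exponent 3/8 leaves 1/2 − 3/8 = 1/8 in the density, a normal of standard deviation 2; its
normalization is the value 2. -/
lemma lintegral_exp_sq_gaussianReal :
    ∫⁻ x, ENNReal.ofReal (Real.exp (3 / 8 * x ^ 2)) ∂(gaussianReal 0 1) = 2 := by
  rw [gaussianReal_of_var_ne_zero _ one_ne_zero,
    lintegral_withDensity_eq_lintegral_mul _ (measurable_gaussianPDF _ _) (by fun_prop)]
  have e : ∀ x : ℝ, (gaussianPDF 0 1 * fun x => ENNReal.ofReal (Real.exp (3 / 8 * x ^ 2))) x =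
      ENNReal.ofReal ((√(2 * Real.pi))⁻¹ * Real.exp (-(1 / 8) * x ^ 2)) := by
    intro x
    rw [Pi.mul_apply, gaussianPDF, gaussianPDFReal, ← ENNReal.ofReal_mul (by positivity),
      mul_assoc, ← Real.exp_add]
    simp only [NNReal.coe_one, mul_one, sub_zero]
    congr 3
    ring
  simp_rw [e]
  rw [← ofReal_integral_eq_lintegral_ofReal
    ((integrable_exp_neg_mul_sq (by norm_num)).const_mul _)
    (Filter.Eventually.of_forall fun _ => by positivity), integral_const_mul, integral_gaussian]
  have : √(Real.pi / (1 / 8)) = 2 * √(2 * Real.pi) := by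
    rw [show Real.pi / (1 / 8) = 2 ^ 2 * (2 * Real.pi) by ring, Real.sqrt_mul (by norm_num),
      Real.sqrt_sq (by norm_num)]
  rw [this, mul_left_comm, inv_mul_cancel₀ (by positivity)]
  simp

/-- A sub-Gaussian variable has a finite exponential moment of its square. -/
lemma lintegral_exp_sq_le {Ω : Type*} [MeasurableSpace Ω] {P : Measure Ω} [IsProbabilityMeasure P]
    {X : Ω → ℝ} {c : ℝ≥0} (hX : Measurable X) (h : HasSubgaussianMGF X c P) {κ : ℝ} (hκ : 0 ≤ κ)
    (hc : κ * c ≤ 3 / 8) :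
    ∫⁻ ω, ENNReal.ofReal (Real.exp (κ * X ω ^ 2)) ∂P ≤ 2 := by
  -- The square is linearized by an auxiliary standard normal variable. After Fubini the
  -- sub-Gaussian bound applies for each of its values x and gives exp(κc·x²), at most exp(3x²/8).
  have key : ∀ y : ℝ, ENNReal.ofReal (Real.exp (κ * y ^ 2)) =
      ∫⁻ x, ENNReal.ofReal (Real.exp (√(2 * κ) * y * x)) ∂(gaussianReal 0 1) := by
    intro y
    rw [← ofReal_integral_eq_lintegral_ofReal (integrable_exp_mul_gaussianReal _)
      (Filter.Eventually.of_forall fun _ => by positivity)]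
    have := congrFun (mgf_fun_id_gaussianReal (μ := 0) (v := 1)) (√(2 * κ) * y)
    rw [mgf] at this
    rw [this, mul_pow, Real.sq_sqrt (by positivity)]
    congr 2
    simp
    ring
  simp_rw [key]
  rw [lintegral_lintegral_swap (by fun_prop)]
  calc ∫⁻ x, ∫⁻ ω, ENNReal.ofReal (Real.exp (√(2 * κ) * X ω * x)) ∂P ∂(gaussianReal 0 1)
      ≤ ∫⁻ x, ENNReal.ofReal (Real.exp (3 / 8 * x ^ 2)) ∂(gaussianReal 0 1) := by
        refine lintegral_mono fun x => ?_
        have := lintegral_exp_mul_le h (√(2 * κ) * x)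
        simp_rw [mul_right_comm _ _ x]
        refine this.trans (ENNReal.ofReal_le_ofReal (Real.exp_le_exp.2 ?_))
        rw [mul_pow, Real.sq_sqrt (by positivity)]
        nlinarith [sq_nonneg x]
    _ = 2 := lintegral_exp_sq_gaussianReal

/-- A Chernoff bound that also covers degenerate sub-Gaussian variables. -/
lemma measure_ge_le_exp_neg {Ω : Type*} [MeasurableSpace Ω] {P : Measure Ω}
    [IsProbabilityMeasure P] {X : Ω → ℝ} {c : ℝ≥0} (h : HasSubgaussianMGF X c P) {ε L : ℝ}
    (hε : 0 < ε) (hL : 2 * c * L ≤ ε ^ 2) :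
    P {ω | ε ≤ X ω} ≤ ENNReal.ofReal (Real.exp (-L)) := by
  -- For c = 0 the usual exponent is a division by zero, and the variable vanishes almost surely
  -- instead.
  rcases eq_or_ne c 0 with rfl | hc
  · have h0 := h.ae_eq_zero_of_hasSubgaussianMGF_zero
    have : P {ω | ε ≤ X ω} = 0 := by
      refine measure_mono_null ?_ (ae_iff.1 h0)
      intro ω hω h1
      simp only [Set.mem_ofPred_eq] at hω
      rw [h1] at hω
      exact absurd hω (not_le.2 hε)
    simp [this]
  · have hc' : (0 : ℝ) < c := by positivity
    rw [← ofReal_measureReal]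
    refine ENNReal.ofReal_le_ofReal ((h.measure_ge_le hε.le).trans (Real.exp_le_exp.2 ?_))
    rw [neg_div, neg_le_neg_iff, le_div_iff₀ (by positivity)]
    linarith

/-! ### The size of the constant C(d). -/

/-- Admissible constants `C(d)` are large. -/
lemma IsCountConstant.lt {d : ℕ} (hd : 0 < d) {C : ℝ} (hC : IsCountConstant d C) :
    16 * (d : ℝ) ^ 2 * (226 * (d : ℝ) ^ 2) ^ d < C := by
  by_contra! hlt
  have hd1 : (1 : ℝ) ≤ d := by exact_mod_cast hd
  -- The defining inequality fails at this i: √i is 4d times a lower bound for the denominator, so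
  -- the exponent is at most 4d < ln i, whence the exponential exceeds 1/i ≥ d/i².
  set i : ℕ := 16 * d ^ 2 * (226 * d ^ 2) ^ d with hi
  have hiR : (i : ℝ) = 16 * (d : ℝ) ^ 2 * (226 * (d : ℝ) ^ 2) ^ d := by rw [hi]; push_cast; ring
  have hd2 : (1 : ℝ) ≤ (d : ℝ) ^ 2 := one_le_pow₀ hd1
  have hpow : (226 : ℝ) ^ d ≤ (226 * (d : ℝ) ^ 2) ^ d := by gcongr; linarith
  have h226 : (1 : ℝ) ≤ 226 ^ d := one_le_pow₀ (by norm_num)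
  have hi1 : (d : ℝ) ≤ i := by rw [hiR]; nlinarith
  have hi226 : (226 : ℝ) ^ d ≤ i := by rw [hiR]; nlinarith
  have hipos : (0 : ℝ) < i := by linarith
  have h := hC i (by exact_mod_cast (hd1.trans hi1)) (by rw [hiR]; exact hlt)
  set l := Real.log i with hl
  have hl4 : 4 * (d : ℝ) < l := by
    rw [hl, Real.lt_log_iff_exp_lt hipos]
    refine lt_of_lt_of_le ?_ hi226
    rw [mul_comm, Real.exp_nat_mul]
    refine pow_lt_pow_left₀ ?_ (Real.exp_pos _).le hd.ne'
    rw [show (4 : ℝ) = (4 : ℕ) * 1 by norm_num, Real.exp_nat_mul]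
    calc Real.exp 1 ^ 4 < 3 ^ 4 := by gcongr; linarith [Real.exp_one_lt_d9]
      _ < 226 := by norm_num
  have hlpos : 0 < l := by linarith
  have hsq : √(i : ℝ) = 4 * d * √(226 * (d : ℝ) ^ 2) ^ d := by
    rw [Real.sqrt_eq_iff_mul_self_eq hipos.le (by positivity), hiR]
    have : √(226 * (d : ℝ) ^ 2) ^ d * √(226 * (d : ℝ) ^ 2) ^ d = (226 * (d : ℝ) ^ 2) ^ d := by
      rw [← mul_pow, Real.mul_self_sqrt (by positivity)]
    rw [mul_mul_mul_comm, this]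
    ring
  -- The number 226 is just below 18 · 3.1415 · 4, the last factor coming from ln i > 4d.
  have hden : √(226 * (d : ℝ) ^ 2) ≤ √(18 * Real.pi * d * l) := by
    refine Real.sqrt_le_sqrt ?_
    have hpi := Real.pi_gt_d4
    have : 18 * 3.1415 * d * (4 * d) ≤ 18 * Real.pi * d * l := by gcongr
    nlinarith
  have hspos : 0 < √(226 * (d : ℝ) ^ 2) := Real.sqrt_pos.2 (by positivity)
  have hx : √(i : ℝ) / √(18 * Real.pi * d * l) ^ d < l := by
    rw [div_lt_iff₀ (pow_pos (hspos.trans_le hden) _), hsq]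
    have := pow_le_pow_left₀ hspos.le hden d
    have := pow_pos hspos d
    nlinarith
  have hlow : (i : ℝ)⁻¹ < Real.exp (-(√(i : ℝ) / √(18 * Real.pi * d * l) ^ d)) := by
    rw [← Real.exp_log hipos, ← Real.exp_neg, Real.exp_lt_exp]
    rw [Real.exp_log hipos]
    linarith
  have hup : (d : ℝ) / (i : ℝ) ^ 2 ≤ (i : ℝ)⁻¹ := by
    rw [div_le_iff₀ (by positivity), sq, inv_mul_cancel_left₀ hipos.ne']
    exact hi1
  linarith

lemma sqrt_two_pi_lt : √(2 * Real.pi) < 2.507 := by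
  rw [Real.sqrt_lt' (by norm_num)]
  linarith [Real.pi_lt_d4]

/-- The left side is the coefficient produced by the odds argument, which the term 2C(d) of the
final bound has to absorb. -/
lemma IsCountConstant.mul_pow_le {d : ℕ} (hd : 0 < d) {C : ℝ} (hC : IsCountConstant d C) :
    64 * d * (√(2 * Real.pi) * Real.exp 3) ^ d ≤ 2 * C := by
  have h := hC.lt hd
  have hd1 : (1 : ℝ) ≤ d := by exact_mod_cast hd
  have hd2 : (1 : ℝ) ≤ (d : ℝ) ^ 2 := one_le_pow₀ hd1
  have he : Real.exp 3 < 21 := by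
    rw [show (3 : ℝ) = (3 : ℕ) * 1 by norm_num, Real.exp_nat_mul]
    calc Real.exp 1 ^ 3 < 2.7183 ^ 3 := by gcongr; linarith [Real.exp_one_lt_d9]
      _ < 21 := by norm_num
  have h1 : √(2 * Real.pi) * Real.exp 3 ≤ 53 := by
    calc √(2 * Real.pi) * Real.exp 3 ≤ 2.507 * 21 := by
          gcongr
          exact sqrt_two_pi_lt.le
      _ ≤ 53 := by norm_num
  obtain ⟨k, hk⟩ : ∃ k, d = k + 1 := Nat.exists_eq_succ_of_ne_zero hd.ne'
  have h2 : (√(2 * Real.pi) * Real.exp 3) ^ d ≤ 53 * 226 ^ k := by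
    calc (√(2 * Real.pi) * Real.exp 3) ^ d ≤ 53 ^ d := by gcongr
      _ = 53 * 53 ^ k := by rw [hk, pow_succ']
      _ ≤ 53 * 226 ^ k := by gcongr; norm_num
  have h3 : 226 * (226 : ℝ) ^ k ≤ (226 * (d : ℝ) ^ 2) ^ d := by
    calc 226 * (226 : ℝ) ^ k = 226 ^ d := by rw [hk, pow_succ']
      _ ≤ (226 * (d : ℝ) ^ 2) ^ d := by gcongr; linarith
  have h4 : (0 : ℝ) < 226 ^ k := by positivity
  have h5 : (d : ℝ) ≤ (d : ℝ) ^ 2 := by nlinarith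
  calc 64 * (d : ℝ) * (√(2 * Real.pi) * Real.exp 3) ^ d
      ≤ 64 * (d : ℝ) ^ 2 * (53 * 226 ^ k) := by gcongr
    _ ≤ 2 * (16 * (d : ℝ) ^ 2 * (226 * 226 ^ k)) := by nlinarith
    _ ≤ 2 * (16 * (d : ℝ) ^ 2 * (226 * (d : ℝ) ^ 2) ^ d) := by gcongr
    _ ≤ 2 * C := by linarith

/-! ### Play counts and noise sums along the plays of one action. -/

section NoiseSums

variable {A Ω : Type*} {d : ℕ}

open Classical in
/-- Sum of the noise vectors of the plays of `a` before episode `t`. -/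
noncomputable def noiseSum (act : ℕ → Ω → A) (ξ : ℕ → Ω → EuclideanSpace ℝ (Fin d)) (a : A) (t : ℕ)
    (ω : Ω) : EuclideanSpace ℝ (Fin d) :=
  ∑ s ∈ (Finset.range t).filter (fun s => act s ω = a), ξ s ω

open Classical in
/-- Sum of the noise vectors of the first `n` plays of `a`, as far as they occur before
episode `t`. -/
noncomputable def truncNoise (act : ℕ → Ω → A) (ξ : ℕ → Ω → EuclideanSpace ℝ (Fin d)) (a : A)
    (n t : ℕ) (ω : Ω) : EuclideanSpace ℝ (Fin d) :=
  ∑ s ∈ (Finset.range t).filter (fun s => act s ω = a ∧ playCount act a s ω < n), ξ s ω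

lemma playCount_zero (act : ℕ → Ω → A) (a : A) (ω : Ω) : playCount act a 0 ω = 0 := by
  simp only [playCount, Finset.range_zero, Finset.filter_empty, Finset.card_empty]

lemma truncNoise_zero (act : ℕ → Ω → A) (ξ : ℕ → Ω → EuclideanSpace ℝ (Fin d)) (a : A) (n : ℕ)
    (ω : Ω) : truncNoise act ξ a n 0 ω = 0 := by
  simp only [truncNoise, Finset.range_zero, Finset.filter_empty, Finset.sum_empty]

open Classical in
lemma playCount_succ (act : ℕ → Ω → A) (a : A) (t : ℕ) (ω : Ω) :
    playCount act a (t + 1) ω = playCount act a t ω + if act t ω = a then 1 else 0 := by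
  rw [playCount, playCount, Finset.range_add_one, Finset.filter_insert]
  split_ifs with h <;> simp

lemma playCount_mono (act : ℕ → Ω → A) (a : A) (ω : Ω) :
    Monotone fun t => playCount act a t ω := by
  classical
  refine monotone_nat_of_le_succ fun t => ?_
  rw [playCount_succ]
  exact Nat.le_add_right _ _

lemma playCount_le (act : ℕ → Ω → A) (a : A) (t : ℕ) (ω : Ω) : playCount act a t ω ≤ t := by
  classical
  rw [playCount]
  exact (Finset.card_filter_le _ _).trans (by simp)

lemma playCount_lt_of_lt {act : ℕ → Ω → A} {a : A} {s t : ℕ} {ω : Ω} (hs : act s ω = a)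
    (hst : s < t) : playCount act a s ω < playCount act a t ω := by
  classical
  refine lt_of_lt_of_le ?_ (playCount_mono act a ω hst)
  simp [playCount_succ, hs]

/-- The number of summands of `noiseSum` is random. Fixing the number n of plays gives a variable
with a clean sub-Gaussian bound, and the two agree when n is the current play count. -/
lemma truncNoise_eq {act : ℕ → Ω → A} (ξ : ℕ → Ω → EuclideanSpace ℝ (Fin d)) (a : A) {t T : ℕ}
    (hT : t ≤ T) (ω : Ω) :
    truncNoise act ξ a (playCount act a t ω) T ω = noiseSum act ξ a t ω := by
  classical
  rw [truncNoise, noiseSum]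
  congr 1
  ext s
  simp only [Finset.mem_filter, Finset.mem_range]
  constructor
  · rintro ⟨-, h1, h2⟩
    exact ⟨lt_of_not_ge fun h => absurd (playCount_mono act a ω h) (not_le.2 h2), h1⟩
  · rintro ⟨h1, h2⟩
    exact ⟨h1.trans_le hT, h2, playCount_lt_of_lt h2 h1⟩

open Classical in
/-- Each play count is attained by at most one play. -/
lemma sum_ite_playCount_le (act : ℕ → Ω → A) (a : A) (n T : ℕ) (ω : Ω) (x : ℝ≥0∞) :
    ∑ t ∈ Finset.range T, (if act t ω = a ∧ playCount act a t ω = n then x else 0) ≤ x := by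
  rw [← Finset.sum_filter, Finset.sum_const]
  have : ((Finset.range T).filter
      (fun t => act t ω = a ∧ playCount act a t ω = n)).card ≤ 1 := by
    rw [Finset.card_le_one]
    intro s hs t ht
    simp only [Finset.mem_filter, Finset.mem_range] at hs ht
    rcases lt_trichotomy s t with h | h | h
    · have := playCount_lt_of_lt hs.2.1 h
      omega
    · exact h
    · have := playCount_lt_of_lt ht.2.1 h
      omega
  calc _ ≤ 1 • x := nsmul_le_nsmul_left (zero_le) this
    _ = x := one_smul _ _

open Classical in
/-- A sum over the plays of `a` is bounded by a sum over its play counts. -/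
lemma sum_plays_le (act : ℕ → Ω → A) (a : A) (T : ℕ) (ω : Ω) (w : ℕ → ℝ≥0∞) (g : ℕ → ℝ≥0∞)
    (hw : ∀ t < T, act t ω = a → w t ≤ g (playCount act a t ω)) :
    ∑ t ∈ Finset.range T, (if act t ω = a then w t else 0) ≤ ∑ n ∈ Finset.range T, g n := by
  -- The play count becomes a second summation variable, and the sums are exchanged.
  calc ∑ t ∈ Finset.range T, (if act t ω = a then w t else 0)
      ≤ ∑ t ∈ Finset.range T, ∑ n ∈ Finset.range T,
          (if act t ω = a ∧ playCount act a t ω = n then g n else 0) := by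
        refine Finset.sum_le_sum fun t ht => ?_
        rw [Finset.mem_range] at ht
        split_ifs with h
        · refine (hw t ht h).trans ?_
          have hm : playCount act a t ω ∈ Finset.range T :=
            Finset.mem_range.2 ((playCount_le act a t ω).trans_lt ht)
          refine le_trans ?_ (Finset.single_le_sum (fun _ _ => zero_le) hm)
          simp [h]
        · exact zero_le
    _ = ∑ n ∈ Finset.range T, ∑ t ∈ Finset.range T,
          (if act t ω = a ∧ playCount act a t ω = n then g n else 0) := Finset.sum_comm
    _ ≤ ∑ n ∈ Finset.range T, g n :=
        Finset.sum_le_sum fun n _ => sum_ite_playCount_le act a n T ω (g n)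

open Classical in
lemma truncNoise_succ (act : ℕ → Ω → A) (ξ : ℕ → Ω → EuclideanSpace ℝ (Fin d)) (a : A) (n t : ℕ)
    (ω : Ω) :
    truncNoise act ξ a n (t + 1) ω = truncNoise act ξ a n t ω +
      if act t ω = a ∧ playCount act a t ω < n then ξ t ω else 0 := by
  rw [truncNoise, truncNoise, Finset.range_add_one, Finset.filter_insert]
  split_ifs with h
  · rw [Finset.sum_insert (by simp), add_comm]
  · simp

end NoiseSums

/-! ### Measurability with respect to the past and the exponential supermartingale. -/

section History

variable {A Ω : Type*} {d : ℕ} [MeasurableSpace A] {act : ℕ → Ω → A}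
  {z : ℕ → Ω → EuclideanSpace ℝ (Fin d)}

lemma measurable_history_act {s t : ℕ} (hst : s < t) : Measurable[history act z t] (act s) := by
  rw [measurable_iff_comap_le]
  exact le_sup_left.trans (le_iSup₂_of_le s (Finset.mem_range.2 hst) le_rfl)

lemma measurable_history_outcome {s t : ℕ} (hst : s < t) : Measurable[history act z t] (z s) := by
  rw [measurable_iff_comap_le]
  exact le_sup_right.trans (le_iSup₂_of_le s (Finset.mem_range.2 hst) le_rfl)

lemma measurable_history_playCount [MeasurableSingletonClass A] (a : A) {s t : ℕ}
    (hst : s ≤ t) :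
    Measurable[history act z t] (playCount act a s) := by
  classical
  induction s with
  | zero =>
    have : playCount act a 0 = fun _ => 0 := funext fun ω => playCount_zero act a ω
    rw [this]
    exact measurable_const
  | succ s ih =>
    have : playCount act a (s + 1) = fun ω => playCount act a s ω +
        if act s ω = a then 1 else 0 := funext fun ω => playCount_succ act a s ω
    rw [this]
    refine (ih (by omega)).add ?_
    exact Measurable.ite (measurable_history_act (by omega) (measurableSet_singleton a))
      measurable_const measurable_const

end History

/-- The σ-algebra of everything the agent has seen, sampled and decided before the noise of
episode `t`. -/
abbrev beforeNoise {A Ω : Type*} {d : ℕ} [MeasurableSpace A] (act : ℕ → Ω → A)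
    (θ : ℕ → Ω → A → EuclideanSpace ℝ (Fin d)) (z : ℕ → Ω → EuclideanSpace ℝ (Fin d)) (t : ℕ) :
    MeasurableSpace Ω :=
  history act z t ⊔ MeasurableSpace.comap (θ t) inferInstance
    ⊔ MeasurableSpace.comap (act t) inferInstance

/-- Modifying a density on an event by an independent factor of mean at most one. -/
lemma lintegral_indicator_mul_le {Ω : Type*} {F G mΩ : MeasurableSpace Ω} {P : Measure Ω}
    (hF : F ≤ mΩ) (hG : G ≤ mΩ) (hind : Indep F G P) {M g : Ω → ℝ≥0∞} {D : Set Ω}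
    (hM : Measurable[F] M) (hD : MeasurableSet[F] D) (hg : Measurable[G] g)
    (hone : ∫⁻ ω, g ω ∂P ≤ 1) :
    ∫⁻ ω, (Dᶜ.indicator M ω + D.indicator M ω * g ω) ∂P ≤ ∫⁻ ω, M ω ∂P := by
  have hDm : MeasurableSet D := hF _ hD
  rw [lintegral_add_left ((hM.mono hF le_rfl).indicator hDm.compl),
    lintegral_mul_eq_lintegral_mul_lintegral_of_independent_measurableSpace hF hG hind
      (hM.indicator hD) hg]
  calc _ ≤ ∫⁻ ω, Dᶜ.indicator M ω ∂P + (∫⁻ ω, D.indicator M ω ∂P) * 1 := by gcongr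
    _ = ∫⁻ ω, M ω ∂P := by
      rw [mul_one, lintegral_indicator hDm, lintegral_indicator hDm.compl, add_comm,
        lintegral_add_compl M hDm]

section Run

variable {A Ω : Type*} {d : ℕ} [Fintype A] [MeasurableSpace A] [mΩ : MeasurableSpace Ω] {P : Measure Ω}
  {f : EuclideanSpace ℝ (Fin d) → ℝ} {μ : A → EuclideanSpace ℝ (Fin d)}
  {act : ℕ → Ω → A} {θ : ℕ → Ω → A → EuclideanSpace ℝ (Fin d)}
  {ξ z : ℕ → Ω → EuclideanSpace ℝ (Fin d)}

namespace IsThompsonRun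

lemma noise_eq (h : IsThompsonRun P f μ act θ ξ z) (t : ℕ) :
    ξ t = fun ω => z t ω - μ (act t ω) := by
  ext1 ω
  rw [h.outcome_eq, add_sub_cancel_left]

/-- The posterior mean in terms of the noise. -/
lemma postMean_apply (h : IsThompsonRun P f μ act θ ξ z) (a : A) (t : ℕ) (ω : Ω) (i : Fin d) :
    postMean act z a t ω i = μ a i +
      (noiseSum act ξ a t ω i - μ a i) / (playCount act a t ω + 1) := by
  classical
  have h1 : ∑ s ∈ (Finset.range t).filter (fun s => act s ω = a), z s ω =
      (playCount act a t ω : ℝ) • μ a + noiseSum act ξ a t ω := by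
    rw [noiseSum, playCount, Nat.cast_smul_eq_nsmul, ← Finset.sum_const, ← Finset.sum_add_distrib]
    refine Finset.sum_congr rfl fun s hs => ?_
    rw [h.outcome_eq, (Finset.mem_filter.1 hs).2]
  have h2 : (playCount act a t ω : ℝ) + 1 ≠ 0 := by positivity
  rw [postMean, h1]
  simp only [PiLp.smul_apply, PiLp.add_apply, smul_eq_mul]
  field_simp
  ring

variable [MeasurableSingletonClass A]

lemma measurable_outcome (h : IsThompsonRun P f μ act θ ξ z) (t : ℕ) : Measurable (z t) := by
  have : z t = fun ω => μ (act t ω) + ξ t ω := funext (h.outcome_eq t)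
  rw [this]
  exact ((measurable_of_finite μ).comp (h.measurable_act t)).add (h.measurable_noise t)

lemma history_le (h : IsThompsonRun P f μ act θ ξ z) (t : ℕ) : history act z t ≤ mΩ :=
  iSup₂_le fun s _ => sup_le (h.measurable_act s).comap_le (h.measurable_outcome s).comap_le

lemma measurable_history_noise (h : IsThompsonRun P f μ act θ ξ z) {s t : ℕ} (hst : s < t) :
    Measurable[history act z t] (ξ s) := by
  rw [h.noise_eq s]
  exact (measurable_history_outcome hst).sub
    ((measurable_of_finite μ).comp (measurable_history_act hst))

lemma measurable_history_truncNoise (h : IsThompsonRun P f μ act θ ξ z) (a : A) (n : ℕ) {s t : ℕ}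
    (hst : s ≤ t) : Measurable[history act z t] (truncNoise act ξ a n s) := by
  classical
  induction s with
  | zero =>
    have : truncNoise act ξ a n 0 = fun _ => 0 := funext fun ω => truncNoise_zero act ξ a n ω
    rw [this]
    exact measurable_const
  | succ s ih =>
    have : truncNoise act ξ a n (s + 1) = fun ω => truncNoise act ξ a n s ω +
        if act s ω = a ∧ playCount act a s ω < n then ξ s ω else 0 :=
      funext fun ω => truncNoise_succ act ξ a n s ω
    rw [this]
    refine (ih (by omega)).add ?_
    refine Measurable.ite ?_ (h.measurable_history_noise (by omega)) measurable_const
    exact (measurable_history_act (by omega) (measurableSet_singleton a)).inter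
      (measurable_history_playCount a (by omega) measurableSet_Iio)

lemma measurable_truncNoise (h : IsThompsonRun P f μ act θ ξ z) (a : A) (n t : ℕ) :
    Measurable (truncNoise act ξ a n t) :=
  (h.measurable_history_truncNoise a n le_rfl).mono (h.history_le t) le_rfl

lemma measurable_playCount (h : IsThompsonRun P f μ act θ ξ z) (a : A) (t : ℕ) :
    Measurable (playCount act a t) :=
  (measurable_history_playCount (z := z) a le_rfl).mono (h.history_le t) le_rfl

/-- The exponential supermartingale of the noise of the first `n` plays. -/
lemma lintegral_exp_truncNoise_le_one [IsProbabilityMeasure P]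
    (h : IsThompsonRun P f μ act θ ξ z) {v : ℝ≥0} {i : Fin d}
    (hsub : ∀ t, HasSubgaussianMGF (fun ω => ξ t ω i) v P) (a : A) (n t : ℕ) (l : ℝ) :
    ∫⁻ ω, ENNReal.ofReal (Real.exp (l * truncNoise act ξ a n t ω i -
      v * l ^ 2 / 2 * (min (playCount act a t ω) n : ℕ))) ∂P ≤ 1 := by
  classical
  induction t with
  | zero => simp [truncNoise_zero, playCount_zero]
  | succ t ih =>
    refine le_trans ?_ ih
    set M : Ω → ℝ≥0∞ := fun ω => ENNReal.ofReal (Real.exp (l * truncNoise act ξ a n t ω i -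
      v * l ^ 2 / 2 * (min (playCount act a t ω) n : ℕ))) with hM
    -- On D the new noise enters the truncated sum and the exponent gains lξ − vl²/2. Off D nothing
    -- changes: another action is played, or n plays have already been made.
    set D : Set Ω := {ω | act t ω = a ∧ playCount act a t ω < n} with hD
    have hFle : beforeNoise act θ z t ≤ mΩ :=
      sup_le (sup_le (h.history_le t) (h.measurable_sample t).comap_le)
        (h.measurable_act t).comap_le
    have hHF : history act z t ≤ beforeNoise act θ z t := le_sup_left.trans le_sup_left
    have hMF : Measurable[beforeNoise act θ z t] M := by
      have h1 : Measurable[beforeNoise act θ z t] fun ω => truncNoise act ξ a n t ω i :=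
        (by fun_prop : Measurable fun x : EuclideanSpace ℝ (Fin d) => x i).comp
          ((h.measurable_history_truncNoise a n le_rfl).mono hHF le_rfl)
      have h2 : Measurable[beforeNoise act θ z t] fun ω => ((min (playCount act a t ω) n : ℕ) : ℝ) :=
        (measurable_of_countable fun k : ℕ => ((min k n : ℕ) : ℝ)).comp
          ((measurable_history_playCount (z := z) a le_rfl).mono hHF le_rfl)
      exact (Real.measurable_exp.comp ((h1.const_mul l).sub (h2.const_mul _))).ennreal_ofReal
    have hDF : MeasurableSet[beforeNoise act θ z t] D := by
      have h1 : Measurable[beforeNoise act θ z t] (act t) := measurable_iff_comap_le.2 le_sup_right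
      exact (h1 (measurableSet_singleton a)).inter
        (((measurable_history_playCount (z := z) a le_rfl).mono hHF le_rfl) measurableSet_Iio)
    have hstep : ∀ ω, ENNReal.ofReal (Real.exp (l * truncNoise act ξ a n (t + 1) ω i -
        v * l ^ 2 / 2 * (min (playCount act a (t + 1) ω) n : ℕ))) =
        Dᶜ.indicator M ω + D.indicator M ω *
          ENNReal.ofReal (Real.exp (l * ξ t ω i - v * l ^ 2 / 2)) := by
      intro ω
      by_cases hω : ω ∈ D
      · have hω' : act t ω = a ∧ playCount act a t ω < n := hω
        rw [Set.indicator_of_notMem (by simpa using hω), Set.indicator_of_mem hω, zero_add, hM,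
          ← ENNReal.ofReal_mul (Real.exp_pos _).le, ← Real.exp_add, truncNoise_succ,
          playCount_succ, if_pos hω', if_pos hω'.1, min_eq_left (by omega : _ + 1 ≤ n),
          min_eq_left hω'.2.le]
        congr 2
        simp
        ring
      · have hω' : ¬ (act t ω = a ∧ playCount act a t ω < n) := hω
        rw [Set.indicator_of_mem (by simpa using hω), Set.indicator_of_notMem hω, zero_mul,
          add_zero, hM, truncNoise_succ, if_neg hω', add_zero]
        have : min (playCount act a (t + 1) ω) n = min (playCount act a t ω) n := by
          rw [playCount_succ]
          split_ifs with h1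
          · have : n ≤ playCount act a t ω := by
              by_contra! hlt
              exact hω' ⟨h1, hlt⟩
            omega
          · rfl
        rw [this]
    simp_rw [hstep]
    have hg : Measurable[MeasurableSpace.comap (ξ t) inferInstance]
        fun ω => ENNReal.ofReal (Real.exp (l * ξ t ω i - v * l ^ 2 / 2)) := by
      have : Measurable fun x : EuclideanSpace ℝ (Fin d) =>
          ENNReal.ofReal (Real.exp (l * x i - v * l ^ 2 / 2)) := by fun_prop
      exact this.comp (comap_measurable (ξ t))
    have hone : ∫⁻ ω, ENNReal.ofReal (Real.exp (l * ξ t ω i - v * l ^ 2 / 2)) ∂P ≤ 1 := by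
      simp_rw [sub_eq_add_neg, Real.exp_add, ENNReal.ofReal_mul (Real.exp_pos _).le]
      rw [lintegral_mul_const' _ _ ENNReal.ofReal_ne_top]
      calc _ ≤ ENNReal.ofReal (Real.exp (v * l ^ 2 / 2)) *
            ENNReal.ofReal (Real.exp (-(v * l ^ 2 / 2))) := by
              gcongr
              exact lintegral_exp_mul_le (hsub t) l
        _ = 1 := by
          rw [← ENNReal.ofReal_mul (Real.exp_pos _).le, ← Real.exp_add]
          simp
    exact lintegral_indicator_mul_le hFle (h.measurable_noise t).comap_le
      (h.noise_indep t).symm hMF hDF hg hone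

/-- The noise of the first `n` plays is sub-Gaussian with parameter `n * v`. -/
lemma hasSubgaussianMGF_truncNoise [IsProbabilityMeasure P]
    (h : IsThompsonRun P f μ act θ ξ z) {v : ℝ≥0} {i : Fin d}
    (hsub : ∀ t, HasSubgaussianMGF (fun ω => ξ t ω i) v P) (a : A) (n t : ℕ) :
    HasSubgaussianMGF (fun ω => truncNoise act ξ a n t ω i) (n * v) P := by
  have hm : Measurable fun ω => truncNoise act ξ a n t ω i :=
    (by fun_prop : Measurable fun x : EuclideanSpace ℝ (Fin d) => x i).comp
      (h.measurable_truncNoise a n t)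
  have key : ∀ l : ℝ, ∫⁻ ω, ENNReal.ofReal (Real.exp (l * truncNoise act ξ a n t ω i)) ∂P ≤
      ENNReal.ofReal (Real.exp ((n * v : ℝ≥0) * l ^ 2 / 2)) := by
    intro l
    have h1 := h.lintegral_exp_truncNoise_le_one hsub a n t l
    -- The random compensator counts at most n plays, so it is bounded by its value at n.
    calc ∫⁻ ω, ENNReal.ofReal (Real.exp (l * truncNoise act ξ a n t ω i)) ∂P
        ≤ ∫⁻ ω, ENNReal.ofReal (Real.exp (l * truncNoise act ξ a n t ω i -
            v * l ^ 2 / 2 * (min (playCount act a t ω) n : ℕ))) *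
              ENNReal.ofReal (Real.exp ((n * v : ℝ≥0) * l ^ 2 / 2)) ∂P := by
          refine lintegral_mono fun ω => ?_
          rw [← ENNReal.ofReal_mul (Real.exp_pos _).le, ← Real.exp_add]
          refine ENNReal.ofReal_le_ofReal (Real.exp_le_exp.2 ?_)
          have h2 : ((min (playCount act a t ω) n : ℕ) : ℝ) ≤ n := by
            exact_mod_cast min_le_right _ _
          have h3 : (0 : ℝ) ≤ v * l ^ 2 / 2 := by positivity
          push_cast at h2 ⊢
          nlinarith
      _ ≤ 1 * ENNReal.ofReal (Real.exp ((n * v : ℝ≥0) * l ^ 2 / 2)) := by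
          rw [lintegral_mul_const' _ _ ENNReal.ofReal_ne_top]
          gcongr
      _ = _ := one_mul _
  have hint : ∀ l : ℝ, Integrable (fun ω => Real.exp (l * truncNoise act ξ a n t ω i)) P := by
    intro l
    refine ⟨(Real.measurable_exp.comp (hm.const_mul l)).aestronglyMeasurable, ?_⟩
    rw [hasFiniteIntegral_iff_ofReal (Filter.Eventually.of_forall fun _ => (Real.exp_pos _).le)]
    exact (key l).trans_lt ENNReal.ofReal_lt_top
  refine ⟨hint, fun l => ?_⟩
  have := key l
  rw [← ofReal_integral_eq_lintegral_ofReal (hint l)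
    (Filter.Eventually.of_forall fun _ => (Real.exp_pos _).le)] at this
  exact (ENNReal.ofReal_le_ofReal_iff (Real.exp_pos _).le).1 this

end IsThompsonRun

end Run

/-! ### Conditional probabilities of samples and posterior odds. -/

/-- Integrating a past-measurable function over an event amounts to integrating it against the
conditional probability of the event. -/
lemma setLIntegral_eq_lintegral_mul_condExp {Ω : Type*} {m mΩ : MeasurableSpace Ω} {P : Measure Ω}
    [IsProbabilityMeasure P] (hm : m ≤ mΩ) {w : Ω → ℝ≥0∞} (hw : Measurable[m] w) {E : Set Ω}
    (hE : MeasurableSet E) :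
    ∫⁻ ω in E, w ω ∂P = ∫⁻ ω, ENNReal.ofReal ((P⟦E | m⟧) ω) * w ω ∂P := by
  have hq : Measurable[m] fun ω => ENNReal.ofReal ((P⟦E | m⟧) ω) :=
    stronglyMeasurable_condExp.measurable.ennreal_ofReal
  have hnn : 0 ≤ᵐ[P] P⟦E | m⟧ :=
    condExp_nonneg (Filter.Eventually.of_forall fun ω => Set.indicator_nonneg (by simp) ω)
  -- Both measures give a past event S the mass P(S ∩ E).
  have hmeas : (P.restrict E).trim hm =
      (P.trim hm).withDensity fun ω => ENNReal.ofReal ((P⟦E | m⟧) ω) := by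
    refine @Measure.ext _ m _ _ fun S hS => ?_
    have hint : Integrable (E.indicator fun _ => (1 : ℝ)) P :=
      (integrable_const 1).indicator hE
    rw [trim_measurableSet_eq hm hS, withDensity_apply _ hS, ← lintegral_indicator hS,
      lintegral_trim hm (hq.indicator hS), lintegral_indicator (hm _ hS),
      ← ofReal_integral_eq_lintegral_ofReal integrable_condExp.integrableOn
        (ae_restrict_of_ae hnn), setIntegral_condExp hm hint hS, Measure.restrict_apply (hm _ hS),
      integral_indicator_const _ hE, smul_eq_mul, mul_one, ofReal_measureReal,
      Measure.restrict_apply hE, Set.inter_comm]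
  rw [← lintegral_trim hm hw, hmeas, lintegral_withDensity_eq_lintegral_mul _ hq hw,
    lintegral_trim hm (hq.mul hw)]
  rfl

section Run

variable {A Ω : Type*} {d : ℕ} [Fintype A]

instance (act : ℕ → Ω → A) (z : ℕ → Ω → EuclideanSpace ℝ (Fin d)) (t : ℕ) (ω : Ω) :
    IsProbabilityMeasure (posterior act z t ω) := by
  unfold posterior
  infer_instance

/-- Under the posterior, the sample of one action is independent of the other samples. -/
lemma posterior_inter [DecidableEq A] (act : ℕ → Ω → A) (z : ℕ → Ω → EuclideanSpace ℝ (Fin d))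
    (t : ℕ) (ω : Ω) (s : A) {U : Set (EuclideanSpace ℝ (Fin d))} (hU : MeasurableSet U)
    {V : Set (((Finset.univ.erase s : Finset A)) → EuclideanSpace ℝ (Fin d))}
    (hV : MeasurableSet V) :
    posterior act z t ω ({x | x s ∈ U} ∩ {x | (fun b : (Finset.univ.erase s : Finset A) => x b) ∈ V})
      = posterior act z t ω {x | x s ∈ U} *
        posterior act z t ω {x | (fun b : (Finset.univ.erase s : Finset A) => x b) ∈ V} := by
  have hi : iIndepFun (fun (b : A) (x : A → EuclideanSpace ℝ (Fin d)) => x b)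
      (posterior act z t ω) :=
    iIndepFun_pi (X := fun _ x => x) fun _ => aemeasurable_id
  have h2 := hi.indepFun_finset {s} (Finset.univ.erase s) (by simp) fun b => measurable_pi_apply b
  have hφ : Measurable fun y : ({s} : Finset A) → EuclideanSpace ℝ (Fin d) =>
      y ⟨s, Finset.mem_singleton_self s⟩ := measurable_pi_apply _
  have h3 := h2.comp hφ measurable_id
  exact h3.measure_inter_preimage_eq_mul _ _ hU hV

lemma posterior_eval (act : ℕ → Ω → A) (z : ℕ → Ω → EuclideanSpace ℝ (Fin d))
    (t : ℕ) (ω : Ω) (s : A) {U : Set (EuclideanSpace ℝ (Fin d))} (hU : MeasurableSet U) :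
    posterior act z t ω {x | x s ∈ U} =
      multivariateGaussian (postMean act z s t ω) (postCov d act s t ω) U :=
  (measurePreserving_eval (fun a => multivariateGaussian (postMean act z a t ω)
    (postCov d act a t ω)) s).measure_preimage hU.nullMeasurableSet

/-- Posterior probability of an orthant. -/
lemma posterior_orthant (act : ℕ → Ω → A) (z : ℕ → Ω → EuclideanSpace ℝ (Fin d))
    (t : ℕ) (ω : Ω) (s : A) (c : Fin d → ℝ) :
    posterior act z t ω {x | ∀ i, c i < x s i} = ∏ i, gaussianReal 0 1
      (Set.Ioi (√((playCount act s t ω : ℝ) + 1) * (c i - postMean act z s t ω i))) := by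
  have hU : MeasurableSet {y : EuclideanSpace ℝ (Fin d) | ∀ i, c i < y i} := by
    rw [Set.ofPred_forall]
    exact MeasurableSet.iInter fun i => measurableSet_lt measurable_const (by fun_prop)
  have hk : (0 : ℝ) < (playCount act s t ω : ℝ) + 1 := by positivity
  rw [← Finset.prod_congr rfl fun i _ => gaussianReal_inv_Ioi (postMean act z s t ω i) (c i) hk]
  refine (posterior_eval act z t ω s hU).trans ?_
  rw [posterior_marginal, Measure.map_apply (by fun_prop) hU, ← Measure.pi_pi]
  congr 1
  ext x
  simp [Set.mem_pi]

/-- Needed to cancel p in p · ((1 − p)/p). -/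
lemma posterior_orthant_ne_zero (act : ℕ → Ω → A) (z : ℕ → Ω → EuclideanSpace ℝ (Fin d))
    (t : ℕ) (ω : Ω) (s : A) (c : Fin d → ℝ) :
    posterior act z t ω {x | ∀ i, c i < x s i} ≠ 0 := by
  rw [posterior_orthant]
  refine Finset.prod_ne_zero_iff.2 fun i _ => ?_
  set x := √((playCount act s t ω : ℝ) + 1) * (c i - postMean act z s t ω i)
  have h1 := (gaussianReal_Ioi_ge (le_max_right x 0)).trans
    (measure_mono (Set.Ioi_subset_Ioi (le_max_left x 0)))
  have h2 : 0 < ENNReal.ofReal ((√(2 * Real.pi))⁻¹ * Real.exp (-(max x 0 + 1) ^ 2 / 2)) :=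
    ENNReal.ofReal_pos.2 (by positivity)
  exact (h2.trans_le h1).ne'

/-- Posterior probability of a half-space. -/
lemma posterior_halfSpace (act : ℕ → Ω → A) (z : ℕ → Ω → EuclideanSpace ℝ (Fin d))
    (t : ℕ) (ω : Ω) (s : A) (i : Fin d) {I : Set ℝ} (hI : MeasurableSet I) :
    posterior act z t ω {x | x s i ∈ I} = gaussianReal (postMean act z s t ω i)
        (((playCount act s t ω : ℝ) + 1)⁻¹).toNNReal I := by
  have hU : MeasurableSet {y : EuclideanSpace ℝ (Fin d) | y i ∈ I} :=
    (by fun_prop : Measurable fun y : EuclideanSpace ℝ (Fin d) => y i) hI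
  refine (posterior_eval act z t ω s hU).trans ?_
  rw [posterior_marginal, Measure.map_apply (by fun_prop) hU]
  exact (measurePreserving_eval (fun i => gaussianReal (postMean act z s t ω i)
    (((playCount act s t ω : ℝ) + 1)⁻¹).toNNReal) i).measure_preimage hI.nullMeasurableSet

/-- Bound for the odds against an orthant, all of whose faces are within distance `x` (in units of
the standard deviation) above the posterior mean. -/
lemma posterior_orthant_odds_le (act : ℕ → Ω → A) (z : ℕ → Ω → EuclideanSpace ℝ (Fin d))
    (t : ℕ) (ω : Ω) (s : A) (c : Fin d → ℝ) {x : ℝ} (hx : 0 ≤ x)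
    (hc : ∀ i, √((playCount act s t ω : ℝ) + 1) * (c i - postMean act z s t ω i) ≤ x) :
    (1 - posterior act z t ω {x | ∀ i, c i < x s i}) /
      posterior act z t ω {x | ∀ i, c i < x s i} ≤
      ENNReal.ofReal ((√(2 * Real.pi) * Real.exp ((x + 1) ^ 2 / 2)) ^ d) := by
  have h1 : ENNReal.ofReal (((√(2 * Real.pi))⁻¹ * Real.exp (-(x + 1) ^ 2 / 2)) ^ d) ≤
      posterior act z t ω {x | ∀ i, c i < x s i} := by
    rw [posterior_orthant, ENNReal.ofReal_pow (by positivity)]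
    calc _ = ∏ _i : Fin d,
          ENNReal.ofReal ((√(2 * Real.pi))⁻¹ * Real.exp (-(x + 1) ^ 2 / 2)) := by simp
      _ ≤ _ := Finset.prod_le_prod' fun i _ =>
          (gaussianReal_Ioi_ge hx).trans (measure_mono (Set.Ioi_subset_Ioi (hc i)))
  calc _ ≤ 1 / ENNReal.ofReal (((√(2 * Real.pi))⁻¹ * Real.exp (-(x + 1) ^ 2 / 2)) ^ d) :=
        ENNReal.div_le_div tsub_le_self h1
    _ = _ := by
      rw [one_div, ← ENNReal.ofReal_inv_of_pos (by positivity), ← inv_pow, mul_inv, inv_inv,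
        ← Real.exp_neg]
      congr 5
      ring

/-- Bound for the odds against an orthant, all of whose faces are at distance at least `y` (in
units of the standard deviation) below the posterior mean. -/
lemma posterior_orthant_odds_le_of_below (act : ℕ → Ω → A)
    (z : ℕ → Ω → EuclideanSpace ℝ (Fin d))
    (t : ℕ) (ω : Ω) (s : A) (c : Fin d → ℝ) {y q : ℝ} (hy : 0 ≤ y)
    (hc : ∀ i, √((playCount act s t ω : ℝ) + 1) * (c i - postMean act z s t ω i) ≤ -y)
    (hq : Real.exp (-y ^ 2 / 2) ≤ q) (hdq : d * q ≤ 1 / 2) :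
    (1 - posterior act z t ω {x | ∀ i, c i < x s i}) /
      posterior act z t ω {x | ∀ i, c i < x s i} ≤ ENNReal.ofReal (2 * d * q) := by
  set p := posterior act z t ω {x | ∀ i, c i < x s i} with hp
  have hk : (0 : ℝ) < (playCount act s t ω : ℝ) + 1 := by positivity
  have hq0 : 0 ≤ q := (Real.exp_pos _).le.trans hq
  have hmeas : MeasurableSet {x : A → EuclideanSpace ℝ (Fin d) | ∀ i, c i < x s i} := by
    rw [Set.ofPred_forall]
    exact MeasurableSet.iInter fun i => measurableSet_lt measurable_const (by fun_prop)
  have h1 : 1 - p ≤ ENNReal.ofReal (d * q) := by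
    rw [hp, ← prob_compl_eq_one_sub hmeas]
    have hsub : {x : A → EuclideanSpace ℝ (Fin d) | ∀ i, c i < x s i}ᶜ ⊆
        ⋃ i, {x | x s i ∈ Set.Iic (c i)} := by
      intro x hx
      simp only [Set.mem_compl_iff, Set.mem_ofPred_eq, not_forall, not_lt] at hx
      simpa using hx
    refine (measure_mono hsub).trans ((measure_iUnion_fintype_le _ _).trans ?_)
    calc _ ≤ ∑ _i : Fin d, ENNReal.ofReal q := by
          refine Finset.sum_le_sum fun i _ => ?_
          rw [posterior_halfSpace _ _ _ _ _ _ measurableSet_Iic, gaussianReal_inv_Iic _ _ hk]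
          exact (measure_mono (Set.Iic_subset_Iic.2 (hc i))).trans
            ((gaussianReal_Iic_neg_le hy).trans (ENNReal.ofReal_le_ofReal hq))
      _ = ENNReal.ofReal (d * q) := by
          rw [ENNReal.ofReal_mul (by positivity)]
          simp
  -- The denominator of the odds is at least 1/2, hence the factor 2.
  have h2 : ENNReal.ofReal (1 / 2) ≤ p := by
    have hp1 : p ≤ 1 := prob_le_one
    have h3 : 1 ≤ p + ENNReal.ofReal (1 / 2) := by
      rw [← tsub_le_iff_left]
      exact h1.trans (ENNReal.ofReal_le_ofReal hdq)
    have h4 : (1 : ℝ≥0∞) = ENNReal.ofReal (1 / 2) + ENNReal.ofReal (1 / 2) := by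
      rw [← ENNReal.ofReal_add (by norm_num) (by norm_num)]
      norm_num
    rw [h4] at h3
    exact (ENNReal.add_le_add_iff_right ENNReal.ofReal_ne_top).1 h3
  calc (1 - p) / p ≤ ENNReal.ofReal (d * q) / ENNReal.ofReal (1 / 2) := ENNReal.div_le_div h1 h2
    _ = ENNReal.ofReal (2 * d * q) := by
      rw [← ENNReal.ofReal_div_of_pos (by norm_num)]
      congr 1
      ring

/-- Posterior probability that a sample exceeds a level far above the posterior mean. -/
lemma posterior_Ici_le (act : ℕ → Ω → A)
    (z : ℕ → Ω → EuclideanSpace ℝ (Fin d)) (t : ℕ) (ω : Ω) (a : A) (i : Fin d) {b δ L : ℝ}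
    (hδ : 0 ≤ δ) (hb : postMean act z a t ω i + δ ≤ b)
    (hL : 2 * L ≤ ((playCount act a t ω : ℝ) + 1) * δ ^ 2) :
    posterior act z t ω {x | x a i ∈ Set.Ici b} ≤ ENNReal.ofReal (Real.exp (-L)) := by
  have hk : (0 : ℝ) < (playCount act a t ω : ℝ) + 1 := by positivity
  rw [posterior_halfSpace _ _ _ _ _ _ measurableSet_Ici, gaussianReal_inv_Ici _ _ hk]
  have h1 : √((playCount act a t ω : ℝ) + 1) * δ ≤
      √((playCount act a t ω : ℝ) + 1) * (b - postMean act z a t ω i) := by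
    gcongr
    linarith
  refine (measure_mono (Set.Ici_subset_Ici.2 h1)).trans
    ((gaussianReal_Ici_le (by positivity)).trans
      (ENNReal.ofReal_le_ofReal (Real.exp_le_exp.2 ?_)))
  rw [mul_pow, Real.sq_sqrt hk.le]
  linarith

variable [MeasurableSpace A] [mΩ : MeasurableSpace Ω] {P : Measure Ω}
  {f : EuclideanSpace ℝ (Fin d) → ℝ} {μ : A → EuclideanSpace ℝ (Fin d)}
  {act : ℕ → Ω → A} {θ : ℕ → Ω → A → EuclideanSpace ℝ (Fin d)}
  {ξ z : ℕ → Ω → EuclideanSpace ℝ (Fin d)}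

namespace IsThompsonRun

lemma ofReal_condExp_ae_eq (h : IsThompsonRun P f μ act θ ξ z) (t : ℕ)
    {B : Set (A → EuclideanSpace ℝ (Fin d))} (hB : MeasurableSet B) :
    (fun ω => ENNReal.ofReal ((P⟦θ t ⁻¹' B | history act z t⟧) ω)) =ᵐ[P]
      fun ω => posterior act z t ω B := by
  filter_upwards [h.sample_law t B hB] with ω hω
  rw [hω, ofReal_measureReal]

variable [MeasurableSingletonClass A] [IsProbabilityMeasure P]

/-- If the posterior probability of `B` is small on the event `D` then a sample in `B` is unlikely
on `D`. -/
lemma measure_sample_inter_le (h : IsThompsonRun P f μ act θ ξ z) (t : ℕ)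
    {B : Set (A → EuclideanSpace ℝ (Fin d))} (hB : MeasurableSet B) {D : Set Ω} {ε : ℝ≥0∞}
    (hD : ∀ ω ∈ D, posterior act z t ω B ≤ ε) :
    P (θ t ⁻¹' B ∩ D) ≤ ε := by
  set q : Ω → ℝ≥0∞ := fun ω => ENNReal.ofReal ((P⟦θ t ⁻¹' B | history act z t⟧) ω) with hq
  have hqm : Measurable[history act z t] q :=
    stronglyMeasurable_condExp.measurable.ennreal_ofReal
  -- D need not be measurable; up to a null set, its part inside the sample event lies in this
  -- past-measurable event.
  set D' : Set Ω := {ω | q ω ≤ ε} with hD'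
  have hD'm : MeasurableSet[history act z t] D' := hqm measurableSet_Iic
  have hEm : MeasurableSet (θ t ⁻¹' B) := h.measurable_sample t hB
  have hle := h.history_le t
  have hae : ∀ᵐ ω ∂P, ω ∈ θ t ⁻¹' B ∩ D → ω ∈ D' ∩ θ t ⁻¹' B := by
    filter_upwards [h.ofReal_condExp_ae_eq t hB] with ω hω hmem
    refine ⟨?_, hmem.1⟩
    change q ω ≤ ε
    rw [hq]
    exact hω.trans_le (hD ω hmem.2)
  calc P (θ t ⁻¹' B ∩ D) ≤ P (D' ∩ θ t ⁻¹' B) := measure_mono_ae hae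
    _ = ∫⁻ ω in θ t ⁻¹' B, D'.indicator 1 ω ∂P := by
      rw [lintegral_indicator_one (hle _ hD'm), Measure.restrict_apply (hle _ hD'm)]
    _ = ∫⁻ ω, q ω * D'.indicator 1 ω ∂P :=
      setLIntegral_eq_lintegral_mul_condExp hle
        ((measurable_const (a := (1 : ℝ≥0∞))).indicator hD'm) hEm
    _ ≤ ∫⁻ _, ε ∂P := by
      refine lintegral_mono fun ω => ?_
      by_cases hω : ω ∈ D'
      · rw [Set.indicator_of_mem hω, Pi.one_apply, mul_one]
        exact hω
      · simp [Set.indicator_of_notMem hω]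
    _ = ε := by simp

/-- The probability that the samples of the other actions satisfy `V` while the sample of `s`
misses the set `U` is at most the expected odds against `U` on the event that `s` is played,
provided that `s` is played as soon as its sample lies in `U` and the others satisfy `V`. -/
lemma measure_miss_le [DecidableEq A] (h : IsThompsonRun P f μ act θ ξ z) (t : ℕ) (s : A)
    {U : Set (EuclideanSpace ℝ (Fin d))} (hU : MeasurableSet U)
    {V : Set (((Finset.univ.erase s : Finset A)) → EuclideanSpace ℝ (Fin d))}
    (hV : MeasurableSet V) (hpos : ∀ ω, posterior act z t ω {x | x s ∈ U} ≠ 0)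
    (hplay : ∀ ω, θ t ω s ∈ U → (fun b : (Finset.univ.erase s : Finset A) => θ t ω b) ∈ V →
      act t ω = s) :
    P {ω | θ t ω s ∉ U ∧ (fun b : (Finset.univ.erase s : Finset A) => θ t ω b) ∈ V} ≤
      ∫⁻ ω in {ω | act t ω = s}, (1 - posterior act z t ω {x | x s ∈ U}) /
        posterior act z t ω {x | x s ∈ U} ∂P := by
  set G : Set (A → EuclideanSpace ℝ (Fin d)) := {x | x s ∈ U} with hG
  set H : Set (A → EuclideanSpace ℝ (Fin d)) :=
    {x | (fun b : (Finset.univ.erase s : Finset A) => x b) ∈ V} with hH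
  have hGm : MeasurableSet G := measurable_pi_apply s hU
  have hres : Measurable fun (x : A → EuclideanSpace ℝ (Fin d))
      (b : (Finset.univ.erase s : Finset A)) => x b :=
    measurable_pi_lambda _ fun b => measurable_pi_apply (b : A)
  have hHm : MeasurableSet H := hres hV
  have hle := h.history_le t
  have hGc : ∀ ω, posterior act z t ω (Gᶜ ∩ H) =
      (1 - posterior act z t ω G) * posterior act z t ω H := by
    intro ω
    have := posterior_inter act z t ω s hU.compl hV
    rw [show {x : A → EuclideanSpace ℝ (Fin d) | x s ∈ Uᶜ} = Gᶜ from rfl,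
      prob_compl_eq_one_sub hGm] at this
    exact this
  have hGH : ∀ ω, posterior act z t ω (G ∩ H) =
      posterior act z t ω G * posterior act z t ω H := fun ω => posterior_inter act z t ω s hU hV
  -- The conditional probability is past-measurable by construction and replaces the posterior
  -- almost everywhere, so measurability of the posterior in ω is never needed.
  set q : Ω → ℝ≥0∞ := fun ω => ENNReal.ofReal ((P⟦θ t ⁻¹' G | history act z t⟧) ω) with hq
  have hqm : Measurable[history act z t] q :=
    stronglyMeasurable_condExp.measurable.ennreal_ofReal
  have hwm : Measurable[history act z t] fun ω => (1 - q ω) / q ω :=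
    (measurable_const.sub hqm).div hqm
  have hq1 := h.ofReal_condExp_ae_eq t hGm
  have hone : ∫⁻ ω in θ t ⁻¹' (Gᶜ ∩ H), 1 ∂P =
      ∫⁻ ω, ENNReal.ofReal ((P⟦θ t ⁻¹' (Gᶜ ∩ H) | history act z t⟧) ω) * 1 ∂P :=
    setLIntegral_eq_lintegral_mul_condExp hle measurable_const
      (h.measurable_sample t (hGm.compl.inter hHm))
  rw [setLIntegral_one] at hone
  calc P {ω | θ t ω s ∉ U ∧ (fun b : (Finset.univ.erase s : Finset A) => θ t ω b) ∈ V}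
      = ∫⁻ ω, ENNReal.ofReal ((P⟦θ t ⁻¹' (Gᶜ ∩ H) | history act z t⟧) ω) * 1 ∂P := hone
    -- Independence splits off the same factor for H on both sides, so exchanging the complement of
    -- G for G costs exactly the odds.
    _ = ∫⁻ ω, ENNReal.ofReal ((P⟦θ t ⁻¹' (G ∩ H) | history act z t⟧) ω) *
          ((1 - q ω) / q ω) ∂P := by
        refine lintegral_congr_ae ?_
        filter_upwards [hq1, h.ofReal_condExp_ae_eq t (hGm.compl.inter hHm),
          h.ofReal_condExp_ae_eq t (hGm.inter hHm)] with ω h1 h2 h3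
        rw [h2, h3, hGc, hGH]
        simp only [hq]
        rw [h1, mul_one, mul_comm (posterior act z t ω G), mul_assoc,
          ENNReal.mul_div_cancel (hpos ω) (measure_ne_top _ _), mul_comm]
    _ = ∫⁻ ω in θ t ⁻¹' (G ∩ H), (1 - q ω) / q ω ∂P :=
        (setLIntegral_eq_lintegral_mul_condExp hle hwm
          (h.measurable_sample t (hGm.inter hHm))).symm
    _ ≤ ∫⁻ ω in {ω | act t ω = s}, (1 - q ω) / q ω ∂P :=
        lintegral_mono_set fun ω hω => hplay ω hω.1 hω.2
    _ = _ := by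
        refine lintegral_congr_ae (ae_restrict_of_ae ?_)
        filter_upwards [hq1] with ω h1
        simp only [hq]
        rw [h1]

end IsThompsonRun

end Run

/-! ### Separation from preference radii. -/

section Radii

variable {A : Type*} [Fintype A] {d : ℕ} {f : EuclideanSpace ℝ (Fin d) → ℝ}
  {μ : A → EuclideanSpace ℝ (Fin d)} {ρ : A → ℝ}

/-- Some optimal action has a ball of estimates that are preferred to all estimates in the balls of
the suboptimal actions. -/
lemma IsPreferenceRadii.exists_separated (hρ : IsPreferenceRadii f μ ρ) :
    ∃ s ∈ argmaxSet f μ, ∀ a ∉ argmaxSet f μ, ∀ x y : EuclideanSpace ℝ (Fin d),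
      (∀ i, |x i - μ s i| < ρ s) → (∀ i, |y i - μ a i| < ρ a) → f y < f x := by
  classical
  by_contra! hcon
  have hcon' : ∀ s, ∃ a, ∃ x y : EuclideanSpace ℝ (Fin d), s ∈ argmaxSet f μ →
      a ∉ argmaxSet f μ ∧ (∀ i, |x i - μ s i| < ρ s) ∧ (∀ i, |y i - μ a i| < ρ a) ∧
        f x ≤ f y := by
    intro s
    by_cases hs : s ∈ argmaxSet f μ
    · obtain ⟨a, ha, x, y, hx, hy, hxy⟩ := hcon s hs
      exact ⟨a, x, y, fun _ => ⟨ha, hx, hy, hxy⟩⟩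
    · exact ⟨s, 0, 0, fun h => absurd h hs⟩
  choose b x y hb using hcon'
  obtain ⟨s₀, hs₀, -⟩ := (hρ.robust μ fun a i => by simpa using hρ.pos a).1
  -- If each optimal s had a counterexample with f(x_s) ≤ f(y_s), the one with the largest f(y_s)
  -- would beat all the others.
  obtain ⟨s₁, hs₁, hmax⟩ := Finset.exists_max_image
    (Finset.univ.filter fun s => s ∈ argmaxSet f μ) (fun s => f (y s)) ⟨s₀, by simpa using hs₀⟩
  replace hs₁ : s₁ ∈ argmaxSet f μ := by simpa using hs₁
  -- Every optimal action receives its bad estimate at once, and only one suboptimal action, `b s₁`,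
  -- receives a good one. Some optimal action maximizes f here with value at most f(y_{s₁}), so `b
  -- s₁` is a maximizer too, against robustness.
  set θ : A → EuclideanSpace ℝ (Fin d) := fun c =>
    if c ∈ argmaxSet f μ then x c else if c = b s₁ then y s₁ else μ c with hθ
  have hball : ∀ c i, |θ c i - μ c i| < ρ c := by
    intro c i
    simp only [hθ]
    split_ifs with h1 h2
    · exact (hb c h1).2.1 i
    · rw [h2]
      exact (hb s₁ hs₁).2.2.1 i
    · simpa using hρ.pos c
  obtain ⟨⟨s₂, hs₂, hs₂'⟩, hsub⟩ := hρ.robust θ hball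
  refine hsub (b s₁) (hb s₁ hs₁).1 fun c => (hs₂' c).trans ?_
  have e1 : θ s₂ = x s₂ := if_pos hs₂
  have e2 : θ (b s₁) = y s₁ := by simp [hθ, (hb s₁ hs₁).1]
  rw [e1, e2]
  exact (hb s₂ hs₂).2.2.2.trans (hmax s₂ (by simpa using hs₂))

/-- The one-sided version: estimates of the optimal action that are not too small are preferred to
estimates of suboptimal actions that are not too large. -/
lemma IsPreferenceRadii.exists_separated_oneSided (hρ : IsPreferenceRadii f μ ρ)
    (hmono : RespectsDominance f) :
    ∃ s ∈ argmaxSet f μ, ∀ a ∉ argmaxSet f μ, ∀ x y : EuclideanSpace ℝ (Fin d),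
      (∀ i, μ s i - ρ s < x i) → (∀ i, y i < μ a i + ρ a) → f y < f x := by
  obtain ⟨s, hs, hsep⟩ := hρ.exists_separated
  refine ⟨s, hs, fun a ha x y hx hy => ?_⟩
  have hs0 := hρ.pos s
  have ha0 := hρ.pos a
  -- The midpoint lies in the ball and strictly below x, so dominance reduces to the two-sided case.
  have h1 : f (WithLp.toLp 2 fun i => (μ s i - ρ s + min (x i) (μ s i)) / 2) ≤ f x := by
    refine hmono _ _ fun i => ?_
    have h2 : μ s i - ρ s < min (x i) (μ s i) := lt_min (hx i) (by linarith)
    have h3 := min_le_left (x i) (μ s i)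
    simp only
    linarith
  have h2 : f y ≤ f (WithLp.toLp 2 fun i => (μ a i + ρ a + max (y i) (μ a i)) / 2) := by
    refine hmono _ _ fun i => ?_
    have h2 : max (y i) (μ a i) < μ a i + ρ a := max_lt (hy i) (by linarith)
    have h3 := le_max_left (y i) (μ a i)
    simp only
    linarith
  refine h2.trans_lt (lt_of_lt_of_le (hsep a ha _ _ (fun i => ?_) fun i => ?_) h1)
  · have h2 : μ s i - ρ s < min (x i) (μ s i) := lt_min (hx i) (by linarith)
    have h3 := min_le_right (x i) (μ s i)
    simp only
    rw [abs_lt]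
    constructor <;> linarith
  · have h2 : max (y i) (μ a i) < μ a i + ρ a := max_lt (hy i) (by linarith)
    have h3 := le_max_right (y i) (μ a i)
    simp only
    rw [abs_lt]
    constructor <;> linarith

end Radii

/-- Separated balls around points of the unit cube are small. -/
lemma add_le_one_of_separated {A : Type*} {d : ℕ} {f : EuclideanSpace ℝ (Fin d) → ℝ}
    {μ : A → EuclideanSpace ℝ (Fin d)} {ρ : A → ℝ} (hμ : ∀ a i, 0 ≤ μ a i ∧ μ a i ≤ 1) {s a : A}
    (hsep : ∀ x y : EuclideanSpace ℝ (Fin d),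
      (∀ i, μ s i - ρ s < x i) → (∀ i, y i < μ a i + ρ a) → f y < f x) :
    ρ s + ρ a ≤ 1 := by
  by_contra! hcon
  -- If the radii added up to more than 1, this midpoint would meet both one-sided conditions and be
  -- preferred to itself.
  set w : EuclideanSpace ℝ (Fin d) :=
    WithLp.toLp 2 fun i => (μ s i - ρ s + (μ a i + ρ a)) / 2 with hw
  have hlt : ∀ i, μ s i - ρ s < μ a i + ρ a := fun i => by
    linarith [(hμ s i).2, (hμ a i).1]
  refine lt_irrefl _ (hsep w w (fun i => ?_) fun i => ?_)
  · have := hlt i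
    simp only [hw]
    linarith
  · have := hlt i
    simp only [hw]
    linarith

/-! ### Odds against a good sample, in terms of the noise. -/

/-- Exponential score of a noise sum over `n` plays. -/
noncomputable def expScore {d : ℕ} (n : ℕ) (S : EuclideanSpace ℝ (Fin d)) : ℝ≥0∞ :=
  ∑ i, ENNReal.ofReal (Real.exp (3 / 2 * d * (S i / √((n : ℝ) + 1)) ^ 2))

lemma measurable_expScore {d : ℕ} (n : ℕ) :
    Measurable (expScore n : EuclideanSpace ℝ (Fin d) → ℝ≥0∞) := by
  unfold expScore
  fun_prop

lemma ofReal_exp_le_expScore {d : ℕ} (n : ℕ) (S : EuclideanSpace ℝ (Fin d)) (i : Fin d) :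
    ENNReal.ofReal (Real.exp (3 / 2 * d * |S i / √((n : ℝ) + 1)| ^ 2)) ≤ expScore n S := by
  rw [sq_abs]
  exact Finset.single_le_sum
    (f := fun i => ENNReal.ofReal (Real.exp (3 / 2 * d * (S i / √((n : ℝ) + 1)) ^ 2)))
    (fun _ _ => zero_le) (Finset.mem_univ i)

section Odds

variable {A Ω : Type*} {d : ℕ} [Fintype A] [MeasurableSpace A] [MeasurableSpace Ω] {P : Measure Ω}
  {f : EuclideanSpace ℝ (Fin d) → ℝ} {μ : A → EuclideanSpace ℝ (Fin d)}
  {act : ℕ → Ω → A} {θ : ℕ → Ω → A → EuclideanSpace ℝ (Fin d)}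
  {ξ z : ℕ → Ω → EuclideanSpace ℝ (Fin d)}

/-- Posterior odds against a sample of action `s` that exceeds `μ s - ρ` in every coordinate. -/
noncomputable def odds (act : ℕ → Ω → A) (z : ℕ → Ω → EuclideanSpace ℝ (Fin d))
    (μ : A → EuclideanSpace ℝ (Fin d)) (s : A) (ρ : ℝ) (t : ℕ) (ω : Ω) : ℝ≥0∞ :=
  (1 - posterior act z t ω {x | ∀ i, μ s i - ρ < x s i}) /
    posterior act z t ω {x | ∀ i, μ s i - ρ < x s i}

namespace IsThompsonRun

/-- This separates the margin √k·ρ, the bias μ/√k from shrinking towards the prior mean 0, and the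
normalized noise. -/
lemma standardized_eq (h : IsThompsonRun P f μ act θ ξ z) (s : A) (ρ : ℝ) (t : ℕ) (ω : Ω)
    (i : Fin d) :
    √((playCount act s t ω : ℝ) + 1) * (μ s i - ρ - postMean act z s t ω i) =
      -(√((playCount act s t ω : ℝ) + 1) * ρ - μ s i / √((playCount act s t ω : ℝ) + 1)) -
        noiseSum act ξ s t ω i / √((playCount act s t ω : ℝ) + 1) := by
  have hk : (0 : ℝ) < (playCount act s t ω : ℝ) + 1 := by positivity
  have hs := Real.sqrt_pos.2 hk
  rw [h.postMean_apply]
  set k := (playCount act s t ω : ℝ) + 1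
  have hkk : k = √k * √k := (Real.mul_self_sqrt hk.le).symm
  have : √k * ((noiseSum act ξ s t ω i - μ s i) / k) =
      (noiseSum act ξ s t ω i - μ s i) / √k := by
    nth_rw 2 [hkk]
    field_simp
  calc √k * (μ s i - ρ - (μ s i + (noiseSum act ξ s t ω i - μ s i) / k))
      = -(√k * ρ) - √k * ((noiseSum act ξ s t ω i - μ s i) / k) := by ring
    _ = _ := by rw [this]; ring

/-- Valid after any number of plays: the prior bias is at most one unit because μ ≤ 1 ≤ √k, and the
worst coordinate M of the normalized noise is dominated by the score. -/
lemma odds_le (h : IsThompsonRun P f μ act θ ξ z) (hd : 0 < d) {s : A} {ρ : ℝ} (hρ : 0 ≤ ρ)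
    (hμ : ∀ i, μ s i ≤ 1) (t : ℕ) (ω : Ω) :
    odds act z μ s ρ t ω ≤ ENNReal.ofReal ((√(2 * Real.pi) * Real.exp 3) ^ d) *
      expScore (playCount act s t ω) (noiseSum act ξ s t ω) := by
  have : Nonempty (Fin d) := ⟨⟨0, hd⟩⟩
  set k := (playCount act s t ω : ℝ) + 1 with hk
  have hk1 : (1 : ℝ) ≤ √k := Real.one_le_sqrt.2 (by simp [hk])
  obtain ⟨j, hj⟩ := Finite.exists_max fun i => |noiseSum act ξ s t ω i / √k|
  set M := |noiseSum act ξ s t ω j / √k| with hM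
  have hM0 : 0 ≤ M := abs_nonneg _
  refine (posterior_orthant_odds_le act z t ω s (fun i => μ s i - ρ) (x := 1 + M) (by linarith)
    fun i => ?_).trans ?_
  · rw [h.standardized_eq]
    have h1 : μ s i / √k ≤ 1 := (div_le_one (by linarith)).2 ((hμ i).trans hk1)
    have h2 : 0 ≤ √k * ρ := by positivity
    have h3 := neg_le_of_abs_le (hj i)
    linarith
  · refine le_trans ?_ (mul_le_mul_right (ofReal_exp_le_expScore _ _ j) _)
    rw [← ENNReal.ofReal_mul (by positivity), ← hk, ← hM]
    refine ENNReal.ofReal_le_ofReal ?_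
    have e : Real.exp (3 / 2 * d * M ^ 2) = Real.exp (3 / 2 * M ^ 2) ^ d := by
      rw [← Real.exp_nat_mul]
      congr 1
      ring
    rw [e, ← mul_pow, mul_assoc, ← Real.exp_add]
    gcongr
    -- (M + 2)²/2 = 3 + 3M²/2 − (M − 1)².
    nlinarith [sq_nonneg (M - 1)]

/-- With margin u, noise up to u/2 leaves the orthant u/2 below the mean and the odds are a Gaussian
tail. Larger noise has M² > 6L, and the surplus in the score exponent pays for the factor exp(−3L).
-/
lemma odds_le_of_large (h : IsThompsonRun P f μ act θ ξ z) (hd : 0 < d) {s : A} {ρ u L : ℝ}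
    (t : ℕ) (ω : Ω) (hu : 0 ≤ u) (huL : 24 * L ≤ u ^ 2)
    (hμ : ∀ i, u ≤ √((playCount act s t ω : ℝ) + 1) * ρ -
      μ s i / √((playCount act s t ω : ℝ) + 1))
    (hL : d * Real.exp (-(3 * L)) ≤ 1 / 2) :
    odds act z μ s ρ t ω ≤ ENNReal.ofReal (2 * d * Real.exp (-(3 * L))) +
      ENNReal.ofReal ((√(2 * Real.pi) * Real.exp (1 - 3 * L)) ^ d) *
        expScore (playCount act s t ω) (noiseSum act ξ s t ω) := by
  have : Nonempty (Fin d) := ⟨⟨0, hd⟩⟩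
  set k := (playCount act s t ω : ℝ) + 1 with hk
  obtain ⟨j, hj⟩ := Finite.exists_max fun i => |noiseSum act ξ s t ω i / √k|
  set M := |noiseSum act ξ s t ω j / √k| with hM
  have hM0 : 0 ≤ M := abs_nonneg _
  have hstd : ∀ i, √k * (μ s i - ρ - postMean act z s t ω i) ≤ -u + M := by
    intro i
    rw [h.standardized_eq]
    have h3 := neg_le_of_abs_le (hj i)
    linarith [hμ i]
  by_cases hMu : M ≤ u / 2
  · refine le_trans ?_ le_self_add
    refine posterior_orthant_odds_le_of_below act z t ω s (fun i => μ s i - ρ) (y := u / 2)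
      (by positivity) (fun i => (hstd i).trans (by linarith)) (Real.exp_le_exp.2 ?_) hL
    linarith
  · push Not at hMu
    refine le_trans ?_ le_add_self
    refine (posterior_orthant_odds_le act z t ω s (fun i => μ s i - ρ) (x := M) hM0
      fun i => (hstd i).trans (by linarith)).trans ?_
    refine le_trans ?_ (mul_le_mul_right (ofReal_exp_le_expScore _ _ j) _)
    rw [← ENNReal.ofReal_mul (by positivity), ← hk, ← hM]
    refine ENNReal.ofReal_le_ofReal ?_
    have e : Real.exp (3 / 2 * d * M ^ 2) = Real.exp (3 / 2 * M ^ 2) ^ d := by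
      rw [← Real.exp_nat_mul]
      congr 1
      ring
    rw [e, ← mul_pow, mul_assoc, ← Real.exp_add]
    gcongr
    nlinarith [sq_nonneg (M - 1)]

/-- The exponential score of the noise of an action has bounded expectation. -/
lemma lintegral_expScore_le [MeasurableSingletonClass A] [IsProbabilityMeasure P]
    (h : IsThompsonRun P f μ act θ ξ z) {σ : ℝ≥0} (hσ : (σ : ℝ) ^ 2 ≤ 1 / (4 * (d : ℝ)))
    (hsub : ∀ t i, HasSubgaussianMGF (fun ω => ξ t ω i) (σ ^ 2) P) (s : A) (n T : ℕ) :
    ∫⁻ ω, expScore n (truncNoise act ξ s n T ω) ∂P ≤ ENNReal.ofReal (2 * d) := by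
  rcases Nat.eq_zero_or_pos d with rfl | hd
  · simp [expScore]
  have hd' : (0 : ℝ) < d := by exact_mod_cast hd
  have hm : ∀ i, Measurable fun ω => truncNoise act ξ s n T ω i := fun i =>
    (by fun_prop : Measurable fun x : EuclideanSpace ℝ (Fin d) => x i).comp
      (h.measurable_truncNoise s n T)
  have hexp : ∀ i, Measurable fun ω => ENNReal.ofReal
      (Real.exp (3 / 2 * d * (truncNoise act ξ s n T ω i / √((n : ℝ) + 1)) ^ 2)) := fun i =>
    (Real.measurable_exp.comp
      ((((hm i).div_const _).pow_const 2).const_mul _)).ennreal_ofReal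
  unfold expScore
  rw [lintegral_finsetSum _ fun i _ => hexp i]
  calc _ ≤ ∑ _i : Fin d, (2 : ℝ≥0∞) := by
        refine Finset.sum_le_sum fun i _ => ?_
        have hk : (0 : ℝ) < (n : ℝ) + 1 := by positivity
        have e : ∀ ω, 3 / 2 * (d : ℝ) * (truncNoise act ξ s n T ω i / √((n : ℝ) + 1)) ^ 2 =
            3 / 2 * d / ((n : ℝ) + 1) * truncNoise act ξ s n T ω i ^ 2 := by
          intro ω
          rw [div_pow, Real.sq_sqrt hk.le]
          ring
        simp_rw [e]
        refine lintegral_exp_sq_le (hm i) (h.hasSubgaussianMGF_truncNoise (fun t => hsub t i) s n T)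
          (by positivity) ?_
        push_cast
        -- The assumption σ² ≤ 1/(4d) enters here: (3/2)·d/(n + 1) · nσ² ≤ 3/8.
        rw [le_div_iff₀ (by positivity)] at hσ
        rw [div_mul_eq_mul_div, div_le_iff₀ hk]
        nlinarith [sq_nonneg (σ : ℝ)]
    _ = ENNReal.ofReal (2 * d) := by
        rw [ENNReal.ofReal_mul (by norm_num)]
        simp [mul_comm]

end IsThompsonRun

end Odds

/-! ### Summing the error events over the episodes. -/

/-- This direction requires no measurability of the integrands, which is not available for the odds.
-/
lemma sum_lintegral_le {Ω : Type*} [MeasurableSpace Ω] (P : Measure Ω) (w : ℕ → Ω → ℝ≥0∞) (T : ℕ) :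
    ∑ t ∈ Finset.range T, ∫⁻ ω, w t ω ∂P ≤ ∫⁻ ω, ∑ t ∈ Finset.range T, w t ω ∂P := by
  induction T with
  | zero => simp
  | succ T ih =>
    simp_rw [Finset.sum_range_succ]
    exact (add_le_add_left ih _).trans (le_lintegral_add _ _)

lemma sum_ite_lt_le {N : ℝ} (hN : 0 ≤ N) (T : ℕ) (x y : ℝ≥0∞) :
    ∑ n ∈ Finset.range T, (if (n : ℝ) + 1 < N then x else y) ≤ ENNReal.ofReal N * x + T * y := by
  rw [Finset.sum_ite, Finset.sum_const, Finset.sum_const, nsmul_eq_mul, nsmul_eq_mul]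
  have h1 : ((Finset.range T).filter fun n : ℕ => (n : ℝ) + 1 < N).card ≤ ⌊N⌋₊ := by
    rw [← Finset.card_range ⌊N⌋₊]
    refine Finset.card_le_card fun n hn => ?_
    rw [Finset.mem_range]
    have := (Finset.mem_filter.1 hn).2
    exact Nat.le_floor (by push_cast; exact this.le)
  have h2 : ((Finset.range T).filter fun n : ℕ => ¬ (n : ℝ) + 1 < N).card ≤ T :=
    (Finset.card_filter_le _ _).trans (by simp)
  refine add_le_add (mul_le_mul_left ?_ _) (mul_le_mul_left (by exact_mod_cast h2) _)
  rw [← ENNReal.ofReal_natCast]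
  exact ENNReal.ofReal_le_ofReal ((Nat.cast_le.2 h1).trans (Nat.floor_le hN))

lemma two_mul_exp_add_le {d : ℕ} (hd : 0 < d) {L : ℝ} (hL : 4 ≤ Real.exp L) :
    2 * d * Real.exp (-(3 * L)) + (√(2 * Real.pi) * Real.exp (1 - 3 * L)) ^ d * (2 * d) ≤
      2 * d * Real.exp (-L) := by
  set E := Real.exp (-L) with hE
  have hE0 : 0 < E := Real.exp_pos _
  have hE4 : E ≤ 1 / 4 := by
    rw [hE, Real.exp_neg, one_div]
    exact inv_anti₀ (by norm_num) hL
  have h3 : Real.exp (-(3 * L)) = E ^ 3 := by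
    rw [hE, ← Real.exp_nat_mul]
    congr 1
    push_cast
    ring
  have hE3 : E ^ 3 ≤ E / 16 := by
    have : E ^ 2 ≤ (1 / 4) ^ 2 := by gcongr
    nlinarith
  have h4 : √(2 * Real.pi) * Real.exp (1 - 3 * L) ≤ E / 2 := by
    rw [sub_eq_add_neg, Real.exp_add, h3]
    calc √(2 * Real.pi) * (Real.exp 1 * E ^ 3) ≤ 2.507 * (2.7183 * (E / 16)) := by
          gcongr
          · exact sqrt_two_pi_lt.le
          · linarith [Real.exp_one_lt_d9]
      _ ≤ E / 2 := by linarith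
  have h5 : (√(2 * Real.pi) * Real.exp (1 - 3 * L)) ^ d ≤ E / 2 :=
    (pow_le_of_le_one (by positivity) (by linarith) hd.ne').trans h4
  rw [h3]
  have hd' : (0 : ℝ) < d := by exact_mod_cast hd
  calc _ ≤ 2 * d * (E / 16) + E / 2 * (2 * d) := by gcongr
    _ ≤ 2 * d * E := by nlinarith

section Run

variable {A Ω : Type*} {d : ℕ} [Fintype A] [MeasurableSpace A] [MeasurableSingletonClass A]
  [MeasurableSpace Ω] {P : Measure Ω} [IsProbabilityMeasure P]
  {f : EuclideanSpace ℝ (Fin d) → ℝ} {μ : A → EuclideanSpace ℝ (Fin d)}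
  {act : ℕ → Ω → A} {θ : ℕ → Ω → A → EuclideanSpace ℝ (Fin d)}
  {ξ z : ℕ → Ω → EuclideanSpace ℝ (Fin d)} {σ : ℝ≥0}

namespace IsThompsonRun

/-- The expected odds against a good sample of `s`, summed over the plays of `s`. -/
lemma sum_lintegral_odds_le (h : IsThompsonRun P f μ act θ ξ z) (hd : 0 < d)
    (hσ : (σ : ℝ) ^ 2 ≤ 1 / (4 * (d : ℝ)))
    (hsub : ∀ t i, HasSubgaussianMGF (fun ω => ξ t ω i) (σ ^ 2) P) {s : A} {ρ L : ℝ} (hρ : 0 < ρ)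
    (hρ1 : ρ ≤ 1) (hμ : ∀ i, μ s i ≤ 1) (hL : 4 * d ≤ Real.exp L) (T : ℕ) :
    ∑ t ∈ Finset.range T, ∫⁻ ω in {ω | act t ω = s}, odds act z μ s ρ t ω ∂P ≤
      ENNReal.ofReal (64 * d * (√(2 * Real.pi) * Real.exp 3) ^ d * (1 + σ) ^ 2 * L / ρ ^ 2 +
        2 * (T * d * Real.exp (-L))) := by
  classical
  have hd1 : (1 : ℝ) ≤ d := by exact_mod_cast hd
  have hL4 : 4 ≤ Real.exp L := by linarith
  have hL1 : 1 ≤ L := by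
    by_contra! hlt
    have := Real.exp_lt_exp.2 hlt
    linarith [Real.exp_one_lt_d9]
  -- Each of the fewer than N early plays costs at most 2d·K₁, giving the coefficient 64d.
  set N : ℝ := 32 * (1 + σ) ^ 2 * L / ρ ^ 2 with hN
  have hN0 : 0 ≤ N := by positivity
  set K₁ : ℝ := (√(2 * Real.pi) * Real.exp 3) ^ d with hK₁
  set K₂ : ℝ := (√(2 * Real.pi) * Real.exp (1 - 3 * L)) ^ d with hK₂
  set K₃ : ℝ := 2 * d * Real.exp (-(3 * L)) with hK₃
  set g : ℕ → Ω → ℝ≥0∞ := fun n ω =>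
    if (n : ℝ) + 1 < N then ENNReal.ofReal K₁ * expScore n (truncNoise act ξ s n T ω)
    else ENNReal.ofReal K₃ + ENNReal.ofReal K₂ * expScore n (truncNoise act ξ s n T ω) with hg
  have hscore : ∀ n, Measurable fun ω => expScore n (truncNoise act ξ s n T ω) := fun n =>
    (measurable_expScore n).comp (h.measurable_truncNoise s n T)
  have hgm : ∀ n, Measurable (g n) := by
    intro n
    simp only [hg]
    split_ifs
    · exact (hscore n).const_mul _
    · exact ((hscore n).const_mul _).const_add _
  have hd3 : d * Real.exp (-(3 * L)) ≤ 1 / 2 := by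
    have e1 : Real.exp (-(3 * L)) = (Real.exp L)⁻¹ * Real.exp (-(2 * L)) := by
      rw [← Real.exp_neg, ← Real.exp_add]
      congr 1
      ring
    have e2 : Real.exp (-(2 * L)) ≤ 1 := Real.exp_le_one_iff.2 (by linarith)
    have e3 : d * (Real.exp L)⁻¹ ≤ 1 / 4 := by
      rw [← div_eq_mul_inv, div_le_iff₀ (Real.exp_pos _)]
      linarith
    rw [e1, ← mul_assoc]
    have := Real.exp_pos (-(2 * L))
    nlinarith
  have hpt : ∀ ω, ∑ t ∈ Finset.range T, (if act t ω = s then odds act z μ s ρ t ω else 0) ≤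
      ∑ n ∈ Finset.range T, g n ω := by
    intro ω
    refine sum_plays_le act s T ω _ (fun n => g n ω) fun t ht _ => ?_
    simp only [hg]
    rw [truncNoise_eq ξ s ht.le]
    split_ifs with hlt
    · exact h.odds_le hd hρ.le hμ t ω
    · set k := (playCount act s t ω : ℝ) + 1 with hk
      have hk0 : 0 < k := by positivity
      have hs := Real.sqrt_pos.2 hk0
      have hNk : 32 * (1 + (σ : ℝ)) ^ 2 * L ≤ k * ρ ^ 2 := by
        rw [not_lt, hN, div_le_iff₀ (by positivity)] at hlt
        exact hlt
      have hσ1 : (1 : ℝ) ≤ (1 + (σ : ℝ)) ^ 2 := one_le_pow₀ (by simp)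
      have hNk' : 32 * L ≤ k * ρ ^ 2 := by nlinarith
      have hkρ : 8 ≤ k * ρ := by
        have : k * ρ ^ 2 ≤ k * ρ := by
          rw [sq, ← mul_assoc]
          exact mul_le_of_le_one_right (by positivity) hρ1
        linarith
      -- The prior bias uses at most an eighth of the margin, and (7/8)² · 32 = 24.5 ≥ 24.
      refine h.odds_le_of_large hd (u := 7 / 8 * (√k * ρ)) t ω (by positivity) ?_ (fun i => ?_) hd3
      · rw [mul_pow, mul_pow, Real.sq_sqrt hk0.le]
        linarith
      · have h1 : μ s i / √k ≤ √k * ρ / 8 := by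
          rw [div_le_iff₀ hs]
          have : √k * ρ / 8 * √k = k * ρ / 8 := by
            rw [div_mul_eq_mul_div, mul_right_comm, Real.mul_self_sqrt hk0.le]
          rw [this]
          linarith [hμ i]
        linarith
  have hg_int : ∀ n, ∫⁻ ω, g n ω ∂P ≤
      if (n : ℝ) + 1 < N then ENNReal.ofReal (K₁ * (2 * d))
      else ENNReal.ofReal (2 * d * Real.exp (-L)) := by
    intro n
    have hs := h.lintegral_expScore_le hσ hsub s n T
    simp only [hg]
    split_ifs
    · rw [lintegral_const_mul _ (hscore n), ENNReal.ofReal_mul (by positivity)]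
      gcongr
    · rw [lintegral_add_left measurable_const, lintegral_const, measure_univ, mul_one,
        lintegral_const_mul _ (hscore n)]
      refine le_trans ?_ (ENNReal.ofReal_le_ofReal (two_mul_exp_add_le hd hL4))
      rw [ENNReal.ofReal_add (by positivity) (by positivity), ← hK₂,
        ENNReal.ofReal_mul (p := K₂) (by positivity)]
      gcongr
  have hind : ∀ t, ∫⁻ ω in {ω | act t ω = s}, odds act z μ s ρ t ω ∂P =
      ∫⁻ ω, (if act t ω = s then odds act z μ s ρ t ω else 0) ∂P := by
    intro t
    have hm : MeasurableSet {ω | act t ω = s} := h.measurable_act t (measurableSet_singleton s)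
    rw [← lintegral_indicator hm]
    refine lintegral_congr fun ω => ?_
    simp [Set.indicator_apply]
  simp_rw [hind]
  calc _ ≤ ∫⁻ ω, ∑ t ∈ Finset.range T,
          (if act t ω = s then odds act z μ s ρ t ω else 0) ∂P := sum_lintegral_le _ _ _
    _ ≤ ∫⁻ ω, ∑ n ∈ Finset.range T, g n ω ∂P := lintegral_mono hpt
    _ = ∑ n ∈ Finset.range T, ∫⁻ ω, g n ω ∂P := lintegral_finsetSum _ fun n _ => hgm n
    _ ≤ ∑ n ∈ Finset.range T, (if (n : ℝ) + 1 < N then ENNReal.ofReal (K₁ * (2 * d))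
          else ENNReal.ofReal (2 * d * Real.exp (-L))) := Finset.sum_le_sum fun n _ => hg_int n
    _ ≤ ENNReal.ofReal N * ENNReal.ofReal (K₁ * (2 * d)) +
          T * ENNReal.ofReal (2 * d * Real.exp (-L)) := sum_ite_lt_le hN0 T _ _
    _ = _ := by
      rw [← ENNReal.ofReal_natCast T, ← ENNReal.ofReal_mul hN0,
        ← ENNReal.ofReal_mul (Nat.cast_nonneg T),
        ← ENNReal.ofReal_add (by positivity) (by positivity)]
      congr 1
      rw [hN]
      ring

/-- A suboptimal action with a sample that is not too large is played only if the sample of `s` is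
too small. -/
lemma measure_play_le_odds (h : IsThompsonRun P f μ act θ ξ z) (hf : Measurable f) {s a : A}
    (hsa : a ≠ s) {ρ : A → ℝ}
    (hsep : ∀ x y : EuclideanSpace ℝ (Fin d),
      (∀ i, μ s i - ρ s < x i) → (∀ i, y i < μ a i + ρ a) → f y < f x) (t : ℕ) :
    P {ω | act t ω = a ∧ ∀ i, θ t ω a i < μ a i + ρ a} ≤
      ∫⁻ ω in {ω | act t ω = s}, odds act z μ s (ρ s) t ω ∂P := by
  classical
  have ha : a ∈ Finset.univ.erase s := by simp [hsa]
  set U : Set (EuclideanSpace ℝ (Fin d)) := {x | ∀ i, μ s i - ρ s < x i} with hU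
  have hUm : MeasurableSet U := by
    rw [hU, Set.ofPred_forall]
    exact MeasurableSet.iInter fun i => measurableSet_lt measurable_const (by fun_prop)
  -- The sample of a is not too large and a beats all actions other than s. This involves only the
  -- samples other than that of s.
  set V : Set (((Finset.univ.erase s : Finset A)) → EuclideanSpace ℝ (Fin d)) :=
    {y | (∀ i, y ⟨a, ha⟩ i < μ a i + ρ a) ∧ ∀ b, f (y b) ≤ f (y ⟨a, ha⟩)} with hV
  have hVm : MeasurableSet V := by
    refine MeasurableSet.inter ?_ ?_
    · change MeasurableSet {y : ((Finset.univ.erase s : Finset A)) → EuclideanSpace ℝ (Fin d) |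
        ∀ i, y ⟨a, ha⟩ i < μ a i + ρ a}
      rw [Set.ofPred_forall]
      exact MeasurableSet.iInter fun i => measurableSet_lt (by fun_prop) measurable_const
    · change MeasurableSet {y : ((Finset.univ.erase s : Finset A)) → EuclideanSpace ℝ (Fin d) |
        ∀ b, f (y b) ≤ f (y ⟨a, ha⟩)}
      rw [Set.ofPred_forall]
      exact MeasurableSet.iInter fun b => measurableSet_le
        (hf.comp (measurable_pi_apply b)) (hf.comp (measurable_pi_apply _))
  refine le_trans (measure_mono ?_) (h.measure_miss_le t s hUm hVm
    (fun ω => posterior_orthant_ne_zero act z t ω s fun i => μ s i - ρ s) ?_)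
  · rintro ω ⟨h1, h2⟩
    have hmax : ∀ b, f (θ t ω b) ≤ f (θ t ω a) := h1 ▸ h.plays_argmax t ω
    exact ⟨fun hs => absurd (hmax s) (not_le.2 (hsep _ _ hs h2)), h2, fun b => hmax b⟩
  -- A good sample of s beats that of a, which is best among the rest, so s is the only maximizer.
  · intro ω hs hv
    by_contra hne
    have hb : act t ω ∈ Finset.univ.erase s := by simp [hne]
    have h1 : f (θ t ω (act t ω)) ≤ f (θ t ω a) := hv.2 ⟨act t ω, hb⟩
    have h2 : f (θ t ω s) ≤ f (θ t ω (act t ω)) := h.plays_argmax t ω s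
    exact absurd (h2.trans h1) (not_le.2 (hsep _ _ hs hv.1))

/-- Expected number of the plays of `a` that belong to its first plays. -/
lemma sum_measure_early_le (h : IsThompsonRun P f μ act θ ξ z) (a : A) {N : ℝ} (hN : 0 ≤ N)
    (T : ℕ) :
    ∑ t ∈ Finset.range T, P {ω | act t ω = a ∧ (playCount act a t ω : ℝ) + 1 < N} ≤
      ENNReal.ofReal N := by
  classical
  have hind : ∀ t, P {ω | act t ω = a ∧ (playCount act a t ω : ℝ) + 1 < N} =
      ∫⁻ ω, (if act t ω = a then (if (playCount act a t ω : ℝ) + 1 < N then 1 else 0) else 0)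
        ∂P := by
    intro t
    have hm : MeasurableSet {ω | act t ω = a ∧ (playCount act a t ω : ℝ) + 1 < N} :=
      (h.measurable_act t (measurableSet_singleton a)).inter
        (h.measurable_playCount a t (MeasurableSet.of_discrete (s := {n : ℕ | (n : ℝ) + 1 < N})))
    rw [← lintegral_indicator_one hm]
    refine lintegral_congr fun ω => ?_
    by_cases h1 : act t ω = a <;> by_cases h2 : (playCount act a t ω : ℝ) + 1 < N <;>
      simp [h1, h2]
  simp_rw [hind]
  calc _ ≤ ∫⁻ ω, ∑ t ∈ Finset.range T, (if act t ω = a then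
          (if (playCount act a t ω : ℝ) + 1 < N then 1 else 0) else 0) ∂P :=
        sum_lintegral_le _ _ _
    _ ≤ ∫⁻ _, ENNReal.ofReal N ∂P := by
        refine lintegral_mono fun ω => ?_
        refine (sum_plays_le act a T ω _ (fun n => if (n : ℝ) + 1 < N then 1 else 0)
          fun t _ _ => le_rfl).trans ((sum_ite_lt_le hN T 1 0).trans ?_)
        simp
    _ = ENNReal.ofReal N := by simp

/-- Expected number of the later plays of `a` before which its average noise is large. -/
lemma sum_measure_noise_le (h : IsThompsonRun P f μ act θ ξ z)
    (hsub : ∀ t i, HasSubgaussianMGF (fun ω => ξ t ω i) (σ ^ 2) P) (a : A) {r L : ℝ}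
    (hr : 0 < r) (T : ℕ) :
    ∑ t ∈ Finset.range T, P {ω | act t ω = a ∧
        2 * (σ : ℝ) ^ 2 * L / r ^ 2 ≤ (playCount act a t ω : ℝ) + 1 ∧
        ∃ i, ((playCount act a t ω : ℝ) + 1) * r ≤ noiseSum act ξ a t ω i} ≤
      ENNReal.ofReal (T * d * Real.exp (-L)) := by
  classical
  set D : ℕ → Set Ω := fun n => {ω | 2 * (σ : ℝ) ^ 2 * L / r ^ 2 ≤ (n : ℝ) + 1 ∧
    ∃ i, ((n : ℝ) + 1) * r ≤ truncNoise act ξ a n T ω i} with hD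
  have hcoord : ∀ n i, Measurable fun ω => truncNoise act ξ a n T ω i := fun n i =>
    (by fun_prop : Measurable fun x : EuclideanSpace ℝ (Fin d) => x i).comp
      (h.measurable_truncNoise a n T)
  have hDm : ∀ n, MeasurableSet (D n) := by
    intro n
    refine (MeasurableSet.const _).inter ?_
    change MeasurableSet {ω | ∃ i, ((n : ℝ) + 1) * r ≤ truncNoise act ξ a n T ω i}
    rw [Set.ofPred_exists]
    exact MeasurableSet.iUnion fun i => measurableSet_le measurable_const (hcoord n i)
  have hDP : ∀ n, P (D n) ≤ ENNReal.ofReal (d * Real.exp (-L)) := by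
    intro n
    by_cases hn : 2 * (σ : ℝ) ^ 2 * L / r ^ 2 ≤ (n : ℝ) + 1
    · rw [div_le_iff₀ (by positivity)] at hn
      calc P (D n) ≤ P (⋃ i, {ω | ((n : ℝ) + 1) * r ≤ truncNoise act ξ a n T ω i}) := by
            refine measure_mono fun ω hω => ?_
            simpa using hω.2
        _ ≤ ∑ i, P {ω | ((n : ℝ) + 1) * r ≤ truncNoise act ξ a n T ω i} :=
            measure_iUnion_fintype_le _ _
        _ ≤ ∑ _i : Fin d, ENNReal.ofReal (Real.exp (-L)) := by
            refine Finset.sum_le_sum fun i _ => measure_ge_le_exp_neg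
              (h.hasSubgaussianMGF_truncNoise (fun t => hsub t i) a n T) (by positivity) ?_
            push_cast
            have hn0 : (0 : ℝ) ≤ n := Nat.cast_nonneg n
            have h0 : 0 ≤ (n : ℝ) * r ^ 2 := by positivity
            -- 2nσ²L ≤ n(n + 1)r² ≤ (n + 1)²r².
            nlinarith [mul_le_mul_of_nonneg_left hn hn0]
        _ = ENNReal.ofReal (d * Real.exp (-L)) := by
            rw [ENNReal.ofReal_mul (Nat.cast_nonneg d)]
            simp
    · have : D n = ∅ := by
        ext ω
        simp only [hD, Set.mem_ofPred_eq, Set.mem_empty_iff_false, iff_false]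
        exact fun hω => hn hω.1
      simp [this]
  have hind : ∀ t ∈ Finset.range T, P {ω | act t ω = a ∧
        2 * (σ : ℝ) ^ 2 * L / r ^ 2 ≤ (playCount act a t ω : ℝ) + 1 ∧
        ∃ i, ((playCount act a t ω : ℝ) + 1) * r ≤ noiseSum act ξ a t ω i} ≤
      ∫⁻ ω, (if act t ω = a then (D (playCount act a t ω)).indicator 1 ω else 0) ∂P := by
    intro t ht
    rw [Finset.mem_range] at ht
    rw [← lintegral_indicator_one₀]
    · refine lintegral_mono fun ω => ?_
      refine Set.indicator_apply_le' (fun hω => ?_) fun _ => zero_le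
      have h2 : ω ∈ D (playCount act a t ω) := by
        simp only [hD, Set.mem_ofPred_eq]
        rw [truncNoise_eq ξ a ht.le]
        exact hω.2
      rw [if_pos hω.1, Set.indicator_of_mem h2]
    · have : {ω | act t ω = a ∧
        2 * (σ : ℝ) ^ 2 * L / r ^ 2 ≤ (playCount act a t ω : ℝ) + 1 ∧
        ∃ i, ((playCount act a t ω : ℝ) + 1) * r ≤ noiseSum act ξ a t ω i} =
          ⋃ n, ({ω | act t ω = a} ∩ {ω | playCount act a t ω = n} ∩ D n) := by
        ext ω
        simp only [hD, Set.mem_ofPred_eq, Set.mem_iUnion, Set.mem_inter_iff]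
        constructor
        · rintro ⟨h1, h2⟩
          refine ⟨_, ⟨h1, rfl⟩, ?_⟩
          rw [truncNoise_eq ξ a ht.le]
          exact h2
        · rintro ⟨n, ⟨h1, rfl⟩, h2⟩
          rw [truncNoise_eq ξ a ht.le] at h2
          exact ⟨h1, h2⟩
      rw [this]
      exact (MeasurableSet.iUnion fun n =>
        ((h.measurable_act t (measurableSet_singleton a)).inter
          (h.measurable_playCount a t (measurableSet_singleton n))).inter
            (hDm n)).nullMeasurableSet
  calc _ ≤ ∑ t ∈ Finset.range T, ∫⁻ ω, (if act t ω = a then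
          (D (playCount act a t ω)).indicator 1 ω else 0) ∂P := Finset.sum_le_sum hind
    _ ≤ ∫⁻ ω, ∑ t ∈ Finset.range T, (if act t ω = a then
          (D (playCount act a t ω)).indicator 1 ω else 0) ∂P := sum_lintegral_le _ _ _
    _ ≤ ∫⁻ ω, ∑ n ∈ Finset.range T, (D n).indicator 1 ω ∂P := by
        refine lintegral_mono fun ω => ?_
        exact sum_plays_le act a T ω _ (fun n => (D n).indicator 1 ω) fun t _ _ => le_rfl
    _ = ∑ n ∈ Finset.range T, P (D n) := by
        rw [lintegral_finsetSum _ fun n _ => measurable_one.indicator (hDm n)]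
        simp_rw [lintegral_indicator_one (hDm _)]
    _ ≤ ∑ _n ∈ Finset.range T, ENNReal.ofReal (d * Real.exp (-L)) :=
        Finset.sum_le_sum fun n _ => hDP n
    _ = ENNReal.ofReal (T * d * Real.exp (-L)) := by
        rw [Finset.sum_const, Finset.card_range, nsmul_eq_mul, mul_assoc (T : ℝ),
          ENNReal.ofReal_mul (Nat.cast_nonneg T), ENNReal.ofReal_natCast]

/-- Probability that after many plays of `a` its sample is far above its posterior mean. -/
lemma measure_sample_ge_le (h : IsThompsonRun P f μ act θ ξ z) (a : A) {r ρ L : ℝ} (hrρ : r < ρ)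
    (t : ℕ) :
    P {ω | ∃ i, 2 * L / (ρ - r) ^ 2 ≤ (playCount act a t ω : ℝ) + 1 ∧
        postMean act z a t ω i ≤ μ a i + r ∧ μ a i + ρ ≤ θ t ω a i} ≤
      ENNReal.ofReal (d * Real.exp (-L)) := by
  rw [Set.ofPred_exists]
  calc _ ≤ ∑ i, P {ω | 2 * L / (ρ - r) ^ 2 ≤ (playCount act a t ω : ℝ) + 1 ∧
        postMean act z a t ω i ≤ μ a i + r ∧ μ a i + ρ ≤ θ t ω a i} :=
        measure_iUnion_fintype_le _ _
    _ ≤ ∑ _i : Fin d, ENNReal.ofReal (Real.exp (-L)) := by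
        refine Finset.sum_le_sum fun i _ => ?_
        have hB : MeasurableSet {x : A → EuclideanSpace ℝ (Fin d) |
            x a i ∈ Set.Ici (μ a i + ρ)} :=
          ((by fun_prop : Measurable fun x : EuclideanSpace ℝ (Fin d) => x i).comp
            (measurable_pi_apply a)) measurableSet_Ici
        refine le_trans (measure_mono ?_) (h.measure_sample_inter_le t hB
          (D := {ω | 2 * L / (ρ - r) ^ 2 ≤ (playCount act a t ω : ℝ) + 1 ∧
            postMean act z a t ω i ≤ μ a i + r}) fun ω hω => ?_)
        · rintro ω ⟨h1, h2, h3⟩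
          exact ⟨h3, h1, h2⟩
        · refine posterior_Ici_le act z t ω a i (δ := ρ - r) (by linarith) ?_ ?_
          · linarith [hω.2]
          · have h1 : 0 < (ρ - r) ^ 2 := pow_pos (by linarith) 2
            exact (div_le_iff₀ h1).1 hω.1
    _ = ENNReal.ofReal (d * Real.exp (-L)) := by
        rw [ENNReal.ofReal_mul (Nat.cast_nonneg d)]
        simp

end IsThompsonRun

end Run

/-! ### The bounds on plays and regret. -/

lemma expectedPlays_le {A Ω : Type*} [MeasurableSpace Ω] (P : Measure Ω) [IsProbabilityMeasure P]
    (act : ℕ → Ω → A) (a : A) (T : ℕ) :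
    expectedPlays P act a T ≤ T := by
  calc expectedPlays P act a T ≤ ∑ _t ∈ Finset.range T, (1 : ℝ) :=
        Finset.sum_le_sum fun t _ => measureReal_le_one
    _ = T := by simp

section Run

variable {A Ω : Type*} {d : ℕ} [Fintype A] [MeasurableSpace A] [MeasurableSingletonClass A]
  [MeasurableSpace Ω] {P : Measure Ω} [IsProbabilityMeasure P]
  {f : EuclideanSpace ℝ (Fin d) → ℝ} {μ : A → EuclideanSpace ℝ (Fin d)}
  {act : ℕ → Ω → A} {θ : ℕ → Ω → A → EuclideanSpace ℝ (Fin d)}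
  {ξ z : ℕ → Ω → EuclideanSpace ℝ (Fin d)} {σ : ℝ≥0}

namespace IsThompsonRun

/-- The bound on the number of plays of a suboptimal action, with a free parameter `L`. -/
lemma expectedPlays_le_of_exp (h : IsThompsonRun P f μ act θ ξ z) (hd : 0 < d)
    (hf : Measurable f) (hσ : (σ : ℝ) ^ 2 ≤ 1 / (4 * (d : ℝ)))
    (hsub : ∀ t i, HasSubgaussianMGF (fun ω => ξ t ω i) (σ ^ 2) P)
    (hμ : ∀ a i, 0 ≤ μ a i ∧ μ a i ≤ 1) {s a : A} (hsa : a ≠ s) {ρ : A → ℝ} (hρs : 0 < ρ s)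
    (hρs1 : ρ s ≤ 1)
    (hsep : ∀ x y : EuclideanSpace ℝ (Fin d),
      (∀ i, μ s i - ρ s < x i) → (∀ i, y i < μ a i + ρ a) → f y < f x)
    {r L : ℝ} (hr : 0 < r) (hrρ : r < ρ a) (hL : 4 * d ≤ Real.exp L) (T : ℕ) :
    expectedPlays P act a T ≤
      64 * d * (√(2 * Real.pi) * Real.exp 3) ^ d * (1 + σ) ^ 2 * L / ρ s ^ 2 +
        2 * L / (ρ a - r) ^ 2 + 2 * σ ^ 2 * L / r ^ 2 + 4 * (T * d * Real.exp (-L)) := by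
  have hd1 : (1 : ℝ) ≤ d := by exact_mod_cast hd
  have hL0 : 0 ≤ L := by
    by_contra! hlt
    have := Real.exp_le_one_iff.2 hlt.le
    linarith
  have hδ : 0 < (ρ a - r) ^ 2 := pow_pos (by linarith) 2
  set N₁ := 2 * L / (ρ a - r) ^ 2 with hN₁
  set N₂ := 2 * (σ : ℝ) ^ 2 * L / r ^ 2 with hN₂
  have hN₁0 : 0 ≤ N₁ := by positivity
  have hN₂0 : 0 ≤ N₂ := by positivity
  have hcover : ∀ t, {ω | act t ω = a} ⊆
      {ω | act t ω = a ∧ ∀ i, θ t ω a i < μ a i + ρ a} ∪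
      ({ω | act t ω = a ∧ (playCount act a t ω : ℝ) + 1 < N₁} ∪
      ({ω | act t ω = a ∧ (playCount act a t ω : ℝ) + 1 < N₂} ∪
      ({ω | act t ω = a ∧ N₂ ≤ (playCount act a t ω : ℝ) + 1 ∧
        ∃ i, ((playCount act a t ω : ℝ) + 1) * r ≤ noiseSum act ξ a t ω i} ∪
      {ω | ∃ i, N₁ ≤ (playCount act a t ω : ℝ) + 1 ∧
        postMean act z a t ω i ≤ μ a i + r ∧ μ a i + ρ a ≤ θ t ω a i}))) := by
    intro t ω hω
    have hω' : act t ω = a := hω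
    simp only [Set.mem_union, Set.mem_ofPred_eq, hω', true_and]
    by_contra! hcon
    obtain ⟨⟨i, hi⟩, h1, h2, h3, h4⟩ := hcon
    have hk : (0 : ℝ) < (playCount act a t ω : ℝ) + 1 := by positivity
    have h5 := h4 i h1
    have h6 := h3 h2 i
    rw [h.postMean_apply] at h5
    refine absurd hi (not_le.2 (h5 ?_))
    -- Since μ_a ≥ 0, shrinking towards 0 only lowers the posterior mean, so an upward deviation is
    -- due to noise alone.
    have h7 : (noiseSum act ξ a t ω i - μ a i) / ((playCount act a t ω : ℝ) + 1) ≤ r := by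
      rw [div_le_iff₀ hk]
      linarith [(hμ a i).1]
    linarith
  have hE : ENNReal.ofReal (expectedPlays P act a T) =
      ∑ t ∈ Finset.range T, P {ω | act t ω = a} := by
    rw [expectedPlays, ENNReal.ofReal_sum_of_nonneg fun t _ => measureReal_nonneg]
    exact Finset.sum_congr rfl fun t _ => ofReal_measureReal
  rw [← ENNReal.ofReal_le_ofReal_iff (by positivity), hE]
  calc ∑ t ∈ Finset.range T, P {ω | act t ω = a}
      ≤ ∑ t ∈ Finset.range T, (P {ω | act t ω = a ∧ ∀ i, θ t ω a i < μ a i + ρ a} +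
        (P {ω | act t ω = a ∧ (playCount act a t ω : ℝ) + 1 < N₁} +
        (P {ω | act t ω = a ∧ (playCount act a t ω : ℝ) + 1 < N₂} +
        (P {ω | act t ω = a ∧ N₂ ≤ (playCount act a t ω : ℝ) + 1 ∧
          ∃ i, ((playCount act a t ω : ℝ) + 1) * r ≤ noiseSum act ξ a t ω i} +
        P {ω | ∃ i, N₁ ≤ (playCount act a t ω : ℝ) + 1 ∧
          postMean act z a t ω i ≤ μ a i + r ∧ μ a i + ρ a ≤ θ t ω a i})))) := by
        refine Finset.sum_le_sum fun t _ => (measure_mono (hcover t)).trans ?_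
        refine (measure_union_le _ _).trans (add_le_add_right ?_ _)
        refine (measure_union_le _ _).trans (add_le_add_right ?_ _)
        refine (measure_union_le _ _).trans (add_le_add_right ?_ _)
        exact measure_union_le _ _
    _ ≤ ENNReal.ofReal (64 * d * (√(2 * Real.pi) * Real.exp 3) ^ d * (1 + σ) ^ 2 * L / ρ s ^ 2 +
          2 * (T * d * Real.exp (-L))) + (ENNReal.ofReal N₁ + (ENNReal.ofReal N₂ +
          (ENNReal.ofReal (T * d * Real.exp (-L)) + ENNReal.ofReal (T * d * Real.exp (-L))))) := by
        simp_rw [Finset.sum_add_distrib]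
        gcongr
        · exact (Finset.sum_le_sum fun t _ => h.measure_play_le_odds hf hsa hsep t).trans
            (h.sum_lintegral_odds_le hd hσ hsub hρs hρs1 (fun i => (hμ s i).2) hL T)
        · exact h.sum_measure_early_le a hN₁0 T
        · exact h.sum_measure_early_le a hN₂0 T
        · exact h.sum_measure_noise_le hsub a hr T
        · refine (Finset.sum_le_sum fun t _ => h.measure_sample_ge_le a hrρ t).trans ?_
          rw [Finset.sum_const, Finset.card_range, nsmul_eq_mul, mul_assoc (T : ℝ),
            ENNReal.ofReal_mul (Nat.cast_nonneg T), ENNReal.ofReal_natCast]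
    _ = _ := by
        rw [← ENNReal.ofReal_add (by positivity) (by positivity),
          ← ENNReal.ofReal_add (by positivity) (by positivity),
          ← ENNReal.ofReal_add (by positivity) (by positivity),
          ← ENNReal.ofReal_add (by positivity) (by positivity)]
        congr 1
        ring

/-- The bound on the number of plays of a suboptimal action. -/
lemma expectedPlays_le_posLog (h : IsThompsonRun P f μ act θ ξ z) (hd : 0 < d)
    (hf : Measurable f) (hσ : (σ : ℝ) ^ 2 ≤ 1 / (4 * (d : ℝ)))
    (hsub : ∀ t i, HasSubgaussianMGF (fun ω => ξ t ω i) (σ ^ 2) P)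
    (hμ : ∀ a i, 0 ≤ μ a i ∧ μ a i ≤ 1) {s a : A} (hgap : 0 < gap f μ s a) {ρ : A → ℝ}
    (hρs : 0 < ρ s) (hρs1 : ρ s ≤ 1)
    (hsep : ∀ x y : EuclideanSpace ℝ (Fin d),
      (∀ i, μ s i - ρ s < x i) → (∀ i, y i < μ a i + ρ a) → f y < f x)
    {r C : ℝ} (hr : 0 < r) (hrρ : r < ρ a) (hC : IsCountConstant d C) (T : ℕ) :
    expectedPlays P act a T ≤
      (2 * C + 8 * d) * (1 + (σ : ℝ)) ^ 2 * Real.posLog (d * T * gap f μ s a ^ 2) / ρ s ^ 2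
        + 2 * Real.posLog (d * T * gap f μ s a ^ 2) / (ρ a - r) ^ 2
        + 2 * (σ : ℝ) ^ 2 * Real.posLog (d * T * gap f μ s a ^ 2) / r ^ 2
        + 4 / gap f μ s a ^ 2 := by
  have hd1 : (1 : ℝ) ≤ d := by exact_mod_cast hd
  have hCK := hC.mul_pow_le hd
  set K : ℝ := 64 * d * (√(2 * Real.pi) * Real.exp 3) ^ d with hK
  have hK0 : 0 ≤ K := by positivity
  set D := gap f μ s a with hD
  have hlog : 0 ≤ Real.posLog (d * T * D ^ 2) := Real.posLog_nonneg
  have hδ : 0 < ρ a - r := by linarith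
  have hC0 : 0 ≤ 2 * C + 8 * d := by linarith
  -- For small T the term 4/Δ² alone suffices; otherwise L = ln(dTΔ²) satisfies 4d ≤ exp(L).
  rcases le_or_gt ((d : ℝ) * T * D ^ 2) (4 * d) with hT | hT
  · have h1 : (T : ℝ) ≤ 4 / D ^ 2 := by
      rw [le_div_iff₀ (by positivity)]
      have : (d : ℝ) * (T * D ^ 2) ≤ d * 4 := by linarith
      exact le_of_mul_le_mul_left this (by linarith)
    refine (expectedPlays_le P act a T).trans (h1.trans ?_)
    have h2 : 0 ≤ (2 * C + 8 * d) * (1 + (σ : ℝ)) ^ 2 * Real.posLog (d * T * D ^ 2) / ρ s ^ 2 :=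
      div_nonneg (mul_nonneg (mul_nonneg hC0 (by positivity)) hlog) (by positivity)
    have h3 : 0 ≤ 2 * Real.posLog (d * T * D ^ 2) / (ρ a - r) ^ 2 := by positivity
    have h4 : 0 ≤ 2 * (σ : ℝ) ^ 2 * Real.posLog (d * T * D ^ 2) / r ^ 2 := by positivity
    linarith
  · have hpos : 0 < (d : ℝ) * T * D ^ 2 := by linarith
    have hT0 : (0 : ℝ) < T := by
      rcases Nat.eq_zero_or_pos T with rfl | h0
      · simp at hpos
      · exact_mod_cast h0
    have hne : a ≠ s := by
      rintro rfl
      simp [hD, gap] at hgap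
    have hlogeq : Real.posLog (d * T * D ^ 2) = Real.log (d * T * D ^ 2) :=
      Real.posLog_eq_log (by rw [abs_of_pos hpos]; linarith)
    have hmain := h.expectedPlays_le_of_exp hd hf hσ hsub hμ hne hρs hρs1 hsep hr hrρ
      (L := Real.posLog (d * T * D ^ 2)) (by rw [hlogeq, Real.exp_log hpos]; exact hT.le) T
    have h4 : 4 * (T * d * Real.exp (-Real.posLog (d * T * D ^ 2))) = 4 / D ^ 2 := by
      rw [hlogeq, Real.exp_neg, Real.exp_log hpos]
      field_simp
    rw [h4] at hmain
    refine hmain.trans ?_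
    gcongr
    -- The odds coefficient is already at most 2C(d); the summand 8d is slack.
    linarith

end IsThompsonRun

/-- The expected regret in terms of the expected number of plays. -/
lemma expectedRegret_eq (hact : ∀ t, Measurable (act t)) {s : A} (hs : s ∈ argmaxSet f μ) (T : ℕ) :
    expectedRegret P f μ s act T =
      ∑ a ∈ suboptimal f μ, gap f μ s a * expectedPlays P act a T := by
  classical
  have h1 : ∀ t, ∫ ω, gap f μ s (act t ω) ∂P =
      ∑ a, gap f μ s a * P.real {ω | act t ω = a} := by
    intro t
    have h2 : ∀ ω, gap f μ s (act t ω) =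
        ∑ a, {ω | act t ω = a}.indicator (fun _ => gap f μ s a) ω := by
      intro ω
      simp [Set.indicator_apply]
    have hm : ∀ a, MeasurableSet {ω | act t ω = a} := fun a => hact t (measurableSet_singleton a)
    simp_rw [h2]
    rw [integral_finsetSum _ fun a _ => (integrable_const _).indicator (hm a)]
    refine Finset.sum_congr rfl fun a _ => ?_
    rw [integral_indicator_const _ (hm a), smul_eq_mul, mul_comm]
  have h3 : ∀ a ∉ suboptimal f μ, gap f μ s a = 0 := by
    intro a ha
    have ha' : a ∈ argmaxSet f μ := by simpa [suboptimal] using ha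
    rw [gap, sub_eq_zero]
    exact le_antisymm (ha' s) (hs a)
  rw [expectedRegret]
  simp_rw [h1, expectedPlays, Finset.mul_sum]
  rw [Finset.sum_comm]
  symm
  refine Finset.sum_subset (Finset.subset_univ _) fun a _ ha => ?_
  simp [h3 a ha]

end Run

end MOBandit

theorem mainTheorem1 {A : Type*} [Fintype A] [Nonempty A] [MeasurableSpace A]
    [MeasurableSingletonClass A] {d : ℕ} (hd : 0 < d)
    (f : EuclideanSpace ℝ (Fin d) → ℝ) (hf : Measurable f) (hmono : MOBandit.RespectsDominance f)
    (μ : A → EuclideanSpace ℝ (Fin d)) (hμ : ∀ a i, 0 ≤ μ a i ∧ μ a i ≤ 1)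
    (ρ : A → ℝ) (hρ : MOBandit.IsPreferenceRadii f μ ρ) :
    ∃ s ∈ MOBandit.argmaxSet f μ,
      ∀ (r : A → ℝ), (∀ a ∈ MOBandit.suboptimal f μ, 0 < r a ∧ r a < ρ a) →
      ∀ (C : ℝ), MOBandit.IsCountConstant d C →
      ∀ (σ : ℝ≥0), (σ : ℝ) ^ 2 ≤ 1 / (4 * (d : ℝ)) →
      ∀ {Ω : Type*} [MeasurableSpace Ω] (P : Measure Ω) [IsProbabilityMeasure P]
        (act : ℕ → Ω → A) (θ : ℕ → Ω → A → EuclideanSpace ℝ (Fin d))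
        (ξ z : ℕ → Ω → EuclideanSpace ℝ (Fin d)),
      MOBandit.IsThompsonRun P f μ act θ ξ z →
      (∀ t i, HasSubgaussianMGF (fun ω => ξ t ω i) (σ ^ 2) P) →
      ∀ T : ℕ,
        (∀ a ∈ MOBandit.suboptimal f μ,
          MOBandit.expectedPlays P act a T ≤
            (2 * C + 8 * d) * (1 + (σ : ℝ)) ^ 2 *
                Real.posLog (d * T * MOBandit.gap f μ s a ^ 2) / ρ s ^ 2
              + 2 * Real.posLog (d * T * MOBandit.gap f μ s a ^ 2) / (ρ a - r a) ^ 2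
              + 2 * (σ : ℝ) ^ 2 * Real.posLog (d * T * MOBandit.gap f μ s a ^ 2) / r a ^ 2
              + 4 / MOBandit.gap f μ s a ^ 2) ∧
        MOBandit.expectedRegret P f μ s act T ≤
          ∑ a ∈ MOBandit.suboptimal f μ, MOBandit.gap f μ s a *
            ((2 * C + 8 * d) * (1 + (σ : ℝ)) ^ 2 *
                Real.posLog (d * T * MOBandit.gap f μ s a ^ 2) / ρ s ^ 2
              + 2 * Real.posLog (d * T * MOBandit.gap f μ s a ^ 2) / (ρ a - r a) ^ 2
              + 2 * (σ : ℝ) ^ 2 * Real.posLog (d * T * MOBandit.gap f μ s a ^ 2) / r a ^ 2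
              + 4 / MOBandit.gap f μ s a ^ 2) := by
  obtain ⟨s, hs, hsep⟩ := hρ.exists_separated_oneSided hmono
  refine ⟨s, hs, ?_⟩
  intro r hr C hC σ hσ Ω _ P _ act θ ξ z h hsub T
  have hgap : ∀ a ∈ MOBandit.suboptimal f μ, a ∉ MOBandit.argmaxSet f μ ∧
      0 < MOBandit.gap f μ s a := by
    intro a ha
    have ha' : a ∉ MOBandit.argmaxSet f μ := by simpa [MOBandit.suboptimal] using ha
    refine ⟨ha', sub_pos.2 (hsep a ha' _ _ (fun i => ?_) fun i => ?_)⟩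
    · linarith [hρ.pos s]
    · linarith [hρ.pos a]
  have hplays : ∀ a ∈ MOBandit.suboptimal f μ, _ := fun a ha =>
    h.expectedPlays_le_posLog hd hf hσ hsub hμ (hgap a ha).2 (hρ.pos s)
      -- ρ_s ≤ 1 follows from ρ_s + ρ_a ≤ 1 for the suboptimal a at hand.
      (by linarith [MOBandit.add_le_one_of_separated hμ (hsep a (hgap a ha).1), hρ.pos a])
      (hsep a (hgap a ha).1) (hr a ha).1 (hr a ha).2 hC T
  refine ⟨hplays, ?_⟩
  rw [MOBandit.expectedRegret_eq h.measurable_act hs]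
  exact Finset.sum_le_sum fun a ha => mul_le_mul_of_nonneg_left (hplays a ha) (hgap a ha).2.le
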